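/- An $\omega$-precategory is an $\omega$-globular set $C$ with identities $C_k\to C_{k+1}$ and, for $k,l\ge 1$ and $i=\min(k,l)-1$, compositions $*_i\colon C_k\times_i C_l\to C_{\max(k,l)}$ (the target $i$-cell of the first argument being the source $i$-cell of the second), satisfying the usual boundary, unit, associativity and distributivity ($u*_i(v*_jv')=(u*_iv)*_j(u*_iv')$ and $(v*_jv')*_iu=(v*_iu)*_j(v'*_iu)$ for $i<j$) axioms, but no interchange law. An $\omega$-polygraph $P$ (of precategories) consists of sets $P_k$ ($k\in\mathbb N$) of $k$-generators together with, for every $(k+1)$-generator $g$, two parallel $k$-cells $\partial^-(g)$ and $\partial^+(g)$ (its source and target) of the precategory freely generated by the generators of dimension at most $k$; $P^*$ denotes the $\omega$-precategory freely generated by $P$. A morphism $F\colon P\to Q$ consists of maps $F_k\colon P_k\to Q_k$ compatible with sources and targets; it induces $F^*\colon P^*\to Q^*$. Write $|P|=\bigsqcup_k P_k$ and $|P^*|=\bigsqcup_k (P^*)_k$. Let $\mathrm{Pol}$ (resp. $\mathrm{Pol}^*$) denote the category of $\omega$-polygraphs equipped with the concretization functor $P\mapsto |P|$ (resp. $P\mapsto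 |P^*|$) to $\mathbf{Set}$. For a category $\mathcal C$ with a functor $|\cdot|\colon\mathcal C\to\mathbf{Set}$, the objects of $\mathrm{Elt}(\mathcal C)$ are the pairs $(X,x)$ with $x\in|X|$, and its morphisms $(X,x)\to(Y,y)$ are the morphisms $f\colon X\to Y$ of $\mathcal C$ with $|f|(x)=y$. An object $(X,x)$ is principal if every morphism $f\colon(Y,y)\to(X,x)$ of $\mathrm{Elt}(\mathcal C)$ such that $f$ is a monomorphism of $\mathcal C$ is an isomorphism. The support $\mathrm{supp}(u)\subseteq|P|$ of a cell $u$ of $P^*$ is defined inductively by $\mathrm{supp}(g)=\{g\}$ for $g\in P_0$; $\mathrm{supp}(g)=\{g\}\cup\mathrm{supp}(\partial^-(g))\cup\mathrm{supp}(\partial^+(g))$ for $g\in P_{k+1}$; $\mathrm{supp}(\mathrm{id}_u)=\mathrm{supp}(u)$; and $\mathrm{supp}(u*_iv)=\mathrm{supp}(u)\cup\mathrm{supp}(v)$. **Lemma.** An element $(P,u)$ of $\mathrm{Elt}(\mathrm{Pol})$ (resp. of $\mathrm{Elt}(\mathrm{Pol}^*)$) is principal if and only if $\mathrm{supp}(u)=|P|$,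 where in the first case the generator $u$ is regarded as a cell of $P^*$. -/

import Mathlib

open CategoryTheory

universe u

namespace PrecatPol

/-- The two signs: `src` (written `-`) and `tgt` (written `+`). -/
inductive Side
  | src
  | tgt

/-! ### Precategories of dimension `ω` -/

/-- An `ω`-globular set. The sets `X_k` are presented as the fibres of `dim`, so that `Cell` is the
disjoint union of all the `X_k`; `bd .src` and `bd .tgt` are the source and the target maps from
`X_{k+1}` to `X_k`. A `0`-globe has no boundary, and `bd` is by convention the identity there. -/
structure GlobSet where
  Cell : Type u
  dim : Cell → ℕ
  bd : Side → Cell → Cell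
  bd_of_dim_eq_zero : ∀ ε x, dim x = 0 → bd ε x = x
  dim_bd : ∀ ε x, dim (bd ε x) = dim x - 1
  bd_bd : ∀ ε x, 2 ≤ dim x → bd ε (bd .src x) = bd ε (bd .tgt x)

/-- The iterated source or target of `x` in dimension `i ≤ dim x`. -/
def GlobSet.bdTo (X : GlobSet.{u}) (ε : Side) (i : ℕ) (x : X.Cell) : X.Cell :=
  (X.bd ε)^[X.dim x - i] x

/-- `x ∈ X_k` and `y ∈ X_l`, with `k, l > 0`, form an element of `X_k ×_i X_l` for
`i = min(k,l) - 1`. -/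
def GlobSet.Composable (X : GlobSet.{u}) (x y : X.Cell) : Prop :=
  0 < X.dim x ∧ 0 < X.dim y ∧
    X.bdTo .tgt (min (X.dim x) (X.dim y) - 1) x = X.bdTo .src (min (X.dim x) (X.dim y) - 1) y

/-- An `ω`-precategory. The composite of a `k`-cell and an `l`-cell is along their common boundary
of dimension `min(k,l) - 1` and has dimension `max(k,l)`. (The composability of the composites that
occur in the axioms is a consequence of the other hypotheses and axioms; it is bound as a variable
only in order to form these composites.) -/
structure PreCat extends GlobSet.{u} where
  id : Cell → Cell
  comp : ∀ x y : Cell, toGlobSet.Composable x y → Cell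
  dim_id : ∀ x, dim (id x) = dim x + 1
  dim_comp : ∀ x y h, dim (comp x y h) = max (dim x) (dim y)
  bd_id : ∀ ε x, bd ε (id x) = x
  bd_comp_lt : ∀ ε x y h h', dim x < dim y → bd ε (comp x y h) = comp x (bd ε y) h'
  src_comp_eq : ∀ x y h, dim x = dim y → bd .src (comp x y h) = bd .src x
  tgt_comp_eq : ∀ x y h, dim x = dim y → bd .tgt (comp x y h) = bd .tgt y
  bd_comp_gt : ∀ ε x y h h', dim y < dim x → bd ε (comp x y h) = comp (bd ε x) y h'
  id_comp_le : ∀ x y h, dim x + 1 ≤ dim y → comp (id x) y h = y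
  id_comp_gt : ∀ x y h h', dim y < dim x + 1 → comp (id x) y h = id (comp x y h')
  comp_id_le : ∀ x y h, dim y + 1 ≤ dim x → comp x (id y) h = x
  comp_id_gt : ∀ x y h h', dim x < dim y + 1 → comp x (id y) h = id (comp x y h')
  assoc : ∀ (i : ℕ) (x y z : Cell) (hxy : toGlobSet.Composable x y)
    (hyz : toGlobSet.Composable y z) (h : toGlobSet.Composable (comp x y hxy) z)
    (h' : toGlobSet.Composable x (comp y z hyz)),
    min (dim x) (dim y) = i + 1 → min (dim y) (dim z) = i + 1 → min (dim x) (dim z) = i + 1 →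
    comp (comp x y hxy) z h = comp x (comp y z hyz) h'
  comp_distrib : ∀ (x y z : Cell) (hyz : toGlobSet.Composable y z)
    (h : toGlobSet.Composable x (comp y z hyz)) (hxy : toGlobSet.Composable x y)
    (hxz : toGlobSet.Composable x z)
    (h' : toGlobSet.Composable (comp x y hxy) (comp x z hxz)),
    dim x < min (dim y) (dim z) →
    comp x (comp y z hyz) h = comp (comp x y hxy) (comp x z hxz) h'
  distrib_comp : ∀ (x y z : Cell) (hxy : toGlobSet.Composable x y)
    (h : toGlobSet.Composable (comp x y hxy) z) (hxz : toGlobSet.Composable x z)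
    (hyz : toGlobSet.Composable y z)
    (h' : toGlobSet.Composable (comp x z hxz) (comp y z hyz)),
    dim z < min (dim x) (dim y) →
    comp (comp x y hxy) z h = comp (comp x z hxz) (comp y z hyz) h'

/-- A prefunctor (morphism of `ω`-precategories). -/
@[ext]
structure PreFunctor (C D : PreCat.{u}) where
  toFun : C.Cell → D.Cell
  map_dim : ∀ x, D.dim (toFun x) = C.dim x
  map_bd : ∀ ε x, toFun (C.bd ε x) = D.bd ε (toFun x)
  map_id : ∀ x, toFun (C.id x) = D.id (toFun x)
  map_comp : ∀ x y h h', toFun (C.comp x y h) = D.comp (toFun x) (toFun y) h'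

theorem PreFunctor.map_bdTo {C D : PreCat.{u}} (F : PreFunctor C D) (ε : Side) (i : ℕ)
    (x : C.Cell) : F.toFun (C.bdTo ε i x) = D.bdTo ε i (F.toFun x) := by
  unfold GlobSet.bdTo
  rw [F.map_dim]
  generalize C.dim x - i = m
  induction m generalizing x with
  | zero => rfl
  | succ m ih => rw [Function.iterate_succ_apply, Function.iterate_succ_apply, ih, F.map_bd]

theorem PreFunctor.map_composable {C D : PreCat.{u}} (F : PreFunctor C D) {x y : C.Cell}
    (h : C.Composable x y) : D.Composable (F.toFun x) (F.toFun y) := by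
  refine ⟨by rw [F.map_dim]; exact h.1, by rw [F.map_dim]; exact h.2.1, ?_⟩
  rw [F.map_dim, F.map_dim, ← F.map_bdTo, ← F.map_bdTo, h.2.2]

instance : Category PreCat.{u} where
  Hom C D := PreFunctor C D
  id C := ⟨fun x => x, fun _ => rfl, fun _ _ => rfl, fun _ => rfl, fun _ _ _ _ => rfl⟩
  comp {_ _ _} F G :=
    { toFun := fun x => G.toFun (F.toFun x)
      map_dim := fun x => by rw [G.map_dim, F.map_dim]
      map_bd := fun ε x => by rw [F.map_bd, G.map_bd]
      map_id := fun x => by rw [F.map_id, G.map_id]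
      map_comp := fun x y h h' => by
        rw [F.map_comp x y h (F.map_composable h), G.map_comp] }

/-- The functor sending an `ω`-precategory to the disjoint union of its sets of cells. -/
def cellFunctor : PreCat.{u} ⥤ Type u where
  obj C := C.Cell
  map F := TypeCat.ofHom (PreFunctor.toFun F)

/-! ### Formal expressions -/

/-- Formal expressions built from generators, identities and compositions. -/
inductive Term (G : ℕ → Type u) : Type u
  | gen (k : ℕ) (g : G k) : Term G
  | id (t : Term G) : Term G
  | comp (s t : Term G) : Term G

namespace Term

variable {G H K : ℕ → Type u}

/-- The dimension of an expression. -/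
def dim : Term G → ℕ
  | gen k _ => k
  | id t => t.dim + 1
  | comp s t => max s.dim t.dim

/-- Renaming of the generators. -/
def map (f : ∀ k, G k → H k) : Term G → Term H
  | gen k g => gen k (f k g)
  | id t => id (t.map f)
  | comp s t => comp (s.map f) (t.map f)

theorem dim_map (f : ∀ k, G k → H k) (t : Term G) : (t.map f).dim = t.dim := by
  induction t with
  | gen k g => rfl
  | id t ih => simp [map, dim, ih]
  | comp s t ihs iht => simp [map, dim, ihs, iht]

theorem map_id' (t : Term G) : t.map (fun _ g => g) = t := by
  induction t with
  | gen k g => rfl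
  | id t ih => simp [map, ih]
  | comp s t ihs iht => simp [map, ihs, iht]

theorem map_map (f : ∀ k, G k → H k) (f' : ∀ k, H k → K k) (t : Term G) :
    (t.map f).map f' = t.map (fun k g => f' k (f k g)) := by
  induction t with
  | gen k g => rfl
  | id t ih => simp [map, ih]
  | comp s t ihs iht => simp [map, ihs, iht]

end Term

/-- Sets of generators in each dimension, together with, for every generator of dimension `k+1`, an
expression for its source and one for its target. -/
structure Sig where
  Gen : ℕ → Type u
  bd : Side → ∀ k, Gen (k + 1) → Term Gen

namespace Sig

variable (S : Sig.{u})

/-- The source or target of an expression, as prescribed by the axioms of precategories (and equal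
to the expression itself on the generators of dimension `0`). -/
def bdT (ε : Side) : Term S.Gen → Term S.Gen
  | .gen 0 g => .gen 0 g
  | .gen (k + 1) g => S.bd ε k g
  | .id t => t
  | .comp s t =>
    if s.dim < t.dim then .comp s (bdT ε t)
    else if t.dim < s.dim then .comp (bdT ε s) t
    else match ε with
      | .src => bdT .src s
      | .tgt => bdT .tgt t

/-- The iterated source or target of an expression in dimension `i`. -/
def bdTo (ε : Side) (i : ℕ) (t : Term S.Gen) : Term S.Gen :=
  (S.bdT ε)^[t.dim - i] t

/-- `S.Eqv s t` means: the expressions `s` and `t` are both well-formed (each composition occurring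
in them is between composable cells) and they denote the same cell of the freely generated
precategory, that is, they are related by the congruence generated by the axioms of precategories.
In particular, `S.Eqv t t` says that `t` is well-formed. -/
inductive Eqv : Term S.Gen → Term S.Gen → Prop
  | gen (k g) : Eqv (.gen k g) (.gen k g)
  | symm {s t} : Eqv s t → Eqv t s
  | trans {s t r} : Eqv s t → Eqv t r → Eqv s r
  | id {s t} : Eqv s t → Eqv (.id s) (.id t)
  | comp {s s' t t'} : Eqv s s' → Eqv t t' → 0 < s.dim → 0 < t.dim →
      Eqv (S.bdTo .tgt (min s.dim t.dim - 1) s) (S.bdTo .src (min s.dim t.dim - 1) t) →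
      Eqv (S.bdTo .tgt (min s'.dim t'.dim - 1) s') (S.bdTo .src (min s'.dim t'.dim - 1) t') →
      Eqv (.comp s t) (.comp s' t')
  | id_comp_le {s t} : Eqv t t → s.dim + 1 ≤ t.dim → Eqv s (S.bdTo .src s.dim t) →
      Eqv (.comp (.id s) t) t
  | id_comp_gt {s t} : Eqv (.comp s t) (.comp s t) → t.dim < s.dim + 1 →
      Eqv (.comp (.id s) t) (.id (.comp s t))
  | comp_id_le {s t} : Eqv s s → t.dim + 1 ≤ s.dim → Eqv (S.bdTo .tgt t.dim s) t →
      Eqv (.comp s (.id t)) s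
  | comp_id_gt {s t} : Eqv (.comp s t) (.comp s t) → s.dim < t.dim + 1 →
      Eqv (.comp s (.id t)) (.id (.comp s t))
  | assoc (i : ℕ) {s t r} :
      min s.dim t.dim = i + 1 → min t.dim r.dim = i + 1 → min s.dim r.dim = i + 1 →
      Eqv (.comp (.comp s t) r) (.comp (.comp s t) r) →
      Eqv (.comp s (.comp t r)) (.comp s (.comp t r)) →
      Eqv (.comp (.comp s t) r) (.comp s (.comp t r))
  | comp_distrib {s t r} : s.dim < min t.dim r.dim →
      Eqv (.comp s (.comp t r)) (.comp s (.comp t r)) →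
      Eqv (.comp (.comp s t) (.comp s r)) (.comp (.comp s t) (.comp s r)) →
      Eqv (.comp s (.comp t r)) (.comp (.comp s t) (.comp s r))
  | distrib_comp {s t r} : r.dim < min s.dim t.dim →
      Eqv (.comp (.comp s t) r) (.comp (.comp s t) r) →
      Eqv (.comp (.comp s r) (.comp t r)) (.comp (.comp s r) (.comp t r)) →
      Eqv (.comp (.comp s t) r) (.comp (.comp s r) (.comp t r))

variable {S}

theorem Eqv.left {s t : Term S.Gen} (h : S.Eqv s t) : S.Eqv s s := h.trans h.symm

theorem Eqv.right {s t : Term S.Gen} (h : S.Eqv s t) : S.Eqv t t := h.symm.trans h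

theorem Eqv.dim_eq {s t : Term S.Gen} (h : S.Eqv s t) : s.dim = t.dim := by
  induction h with
  | gen k g => rfl
  | symm _ ih => exact ih.symm
  | trans _ _ ih ih' => exact ih.trans ih'
  | id _ ih => simp [Term.dim, ih]
  | comp _ _ _ _ _ _ ih ih' => simp [Term.dim, ih, ih']
  | _ => simp only [Term.dim] at *; omega

/-- The immediate subexpressions of a well-formed expression are well-formed and composable. -/
def Good (S : Sig.{u}) : Term S.Gen → Prop
  | .gen _ _ => True
  | .id t => S.Eqv t t
  | .comp s t => S.Eqv s s ∧ S.Eqv t t ∧ 0 < s.dim ∧ 0 < t.dim ∧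
      S.Eqv (S.bdTo .tgt (min s.dim t.dim - 1) s) (S.bdTo .src (min s.dim t.dim - 1) t)

theorem Eqv.good {s t : Term S.Gen} (h : S.Eqv s t) : Good S s ∧ Good S t := by
  induction h with
  | gen k g => exact ⟨trivial, trivial⟩
  | symm _ ih => exact ih.symm
  | trans _ _ ih ih' => exact ⟨ih.1, ih'.2⟩
  | id h ih => exact ⟨h.left, h.right⟩
  | comp h h' p p' c c' =>
    exact ⟨⟨h.left, h'.left, p, p', c⟩, ⟨h.right, h'.right, h.dim_eq ▸ p, h'.dim_eq ▸ p', c'⟩⟩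
  | @id_comp_le s t h hd c ih _ =>
    refine ⟨⟨c.left.id, h, Nat.succ_pos _, by omega, ?_⟩, ih.2⟩
    have e : min (Term.id s).dim t.dim - 1 = s.dim := by simp only [Term.dim]; omega
    rw [e]
    have e' : S.bdTo .tgt s.dim (.id s) = s := by simp [bdTo, Term.dim, bdT]
    rwa [e']
  | @id_comp_gt s t h hd ih =>
    refine ⟨⟨ih.1.1.id, ih.1.2.1, Nat.succ_pos _, ih.1.2.2.2.1, ?_⟩, h⟩
    have e : min (Term.id s).dim t.dim = min s.dim t.dim := by simp only [Term.dim]; omega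
    have e' : S.bdTo .tgt (min s.dim t.dim - 1) (.id s) = S.bdTo .tgt (min s.dim t.dim - 1) s := by
      have e'' : s.dim + 1 - (min s.dim t.dim - 1) = (s.dim - (min s.dim t.dim - 1)) + 1 := by
        omega
      simp only [bdTo, Term.dim]
      rw [e'', Function.iterate_succ_apply]; rfl
    rw [e, e']; exact ih.1.2.2.2.2
  | @comp_id_le s t h hd c ih _ =>
    refine ⟨⟨h, c.right.id, by omega, Nat.succ_pos _, ?_⟩, ih.2⟩
    have e : min s.dim (Term.id t).dim - 1 = t.dim := by simp only [Term.dim]; omega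
    rw [e]
    have e' : S.bdTo .src t.dim (.id t) = t := by simp [bdTo, Term.dim, bdT]
    rwa [e']
  | @comp_id_gt s t h hd ih =>
    refine ⟨⟨ih.1.1, ih.1.2.1.id, ih.1.2.2.1, Nat.succ_pos _, ?_⟩, h⟩
    have e : min s.dim (Term.id t).dim = min s.dim t.dim := by simp only [Term.dim]; omega
    have e' : S.bdTo .src (min s.dim t.dim - 1) (.id t) = S.bdTo .src (min s.dim t.dim - 1) t := by
      have e'' : t.dim + 1 - (min s.dim t.dim - 1) = (t.dim - (min s.dim t.dim - 1)) + 1 := by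
        omega
      simp only [bdTo, Term.dim]
      rw [e'', Function.iterate_succ_apply]; rfl
    rw [e, e']; exact ih.1.2.2.2.2
  | assoc i _ _ _ _ _ ih ih' => exact ⟨ih.1, ih'.1⟩
  | comp_distrib _ _ _ ih ih' => exact ⟨ih.1, ih'.1⟩
  | distrib_comp _ _ _ ih ih' => exact ⟨ih.1, ih'.1⟩

theorem Eqv.comp_inv {s t : Term S.Gen} (h : S.Eqv (.comp s t) (.comp s t)) :
    S.Eqv s s ∧ S.Eqv t t ∧ 0 < s.dim ∧ 0 < t.dim ∧
      S.Eqv (S.bdTo .tgt (min s.dim t.dim - 1) s) (S.bdTo .src (min s.dim t.dim - 1) t) :=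
  h.good.1

theorem Eqv.bdT_of_dim_eq_zero {t : Term S.Gen} (h : S.Eqv t t) (h0 : t.dim = 0) (ε : Side) :
    S.bdT ε t = t := by
  cases t with
  | gen k g => cases h0; rfl
  | id t => simp [Term.dim] at h0
  | comp s t => have := h.comp_inv; simp only [Term.dim] at h0; omega

theorem bdT_comp_lt (ε : Side) {s t : Term S.Gen} (h : s.dim < t.dim) :
    S.bdT ε (.comp s t) = .comp s (S.bdT ε t) := by
  simp [bdT, h]

theorem bdT_comp_gt (ε : Side) {s t : Term S.Gen} (h : t.dim < s.dim) :
    S.bdT ε (.comp s t) = .comp (S.bdT ε s) t := by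
  simp [bdT, h, h.le]

theorem src_comp_eq {s t : Term S.Gen} (h : s.dim = t.dim) :
    S.bdT .src (.comp s t) = S.bdT .src s := by
  simp [bdT, h]

theorem tgt_comp_eq {s t : Term S.Gen} (h : s.dim = t.dim) :
    S.bdT .tgt (.comp s t) = S.bdT .tgt t := by
  simp [bdT, h]

end Sig

/-! ### Polygraphs -/

/-- An `ω`-polygraph of precategories: sets `Gen k` of `k`-generators with, for each
`(k+1)`-generator, two parallel `k`-cells of the precategory freely generated by the generators of
dimension at most `k`. These two cells are given by expressions that represent them. (An expression
of dimension `k` only involves generators of dimension at most `k`. Since morphisms of polygraphs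
are only compared with the represented cells, the identity is an isomorphism between polygraphs
that differ only by the choice of the representing expressions.) -/
structure Pol extends Sig.{u} where
  bd_wf : ∀ ε k (g : Gen (k + 1)), toSig.Eqv (bd ε k g) (bd ε k g)
  dim_bd : ∀ ε k (g : Gen (k + 1)), (bd ε k g).dim = k
  bd_bd : ∀ ε k (g : Gen (k + 2)),
    toSig.Eqv (toSig.bdT ε (bd .src (k + 1) g)) (toSig.bdT ε (bd .tgt (k + 1) g))

namespace Pol

open Sig

variable (P : Pol.{u})

theorem dim_bdT (ε : Side) (t : Term P.Gen) : (P.bdT ε t).dim = t.dim - 1 := by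
  induction t with
  | gen k g =>
    cases k with
    | zero => rfl
    | succ k => exact P.dim_bd ε k g
  | id t ih => rfl
  | comp s t ihs iht =>
    rcases lt_trichotomy s.dim t.dim with h | h | h
    · rw [bdT_comp_lt ε h]; simp only [Term.dim, iht]; omega
    · cases ε
      · rw [src_comp_eq h, ihs]; simp only [Term.dim]; omega
      · rw [tgt_comp_eq h, iht]; simp only [Term.dim]; omega
    · rw [bdT_comp_gt ε h]; simp only [Term.dim, ihs]; omega

theorem dim_iterate (ε : Side) (m : ℕ) (t : Term P.Gen) :
    ((P.bdT ε)^[m] t).dim = t.dim - m := by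
  induction m generalizing t with
  | zero => rfl
  | succ m ih => rw [Function.iterate_succ_apply, ih, dim_bdT]; omega

/-- Compatibility of the boundaries with the congruence, together with globularity. -/
def BdOk (a b : Term P.Gen) : Prop :=
  (∀ ε, P.Eqv (P.bdT ε a) (P.bdT ε b)) ∧
    (2 ≤ a.dim → ∀ ε, P.Eqv (P.bdT ε (P.bdT .src a)) (P.bdT ε (P.bdT .tgt a)))

variable {P}

theorem iterate_aux {n : ℕ} (H : ∀ a b, P.Eqv a b → a.dim < n → P.BdOk a b) (ε : Side) (m : ℕ)
    {a b : Term P.Gen} (h : P.Eqv a b) (hd : a.dim < n) :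
    P.Eqv ((P.bdT ε)^[m] a) ((P.bdT ε)^[m] b) := by
  induction m generalizing a b with
  | zero => exact h
  | succ m ih =>
    rw [Function.iterate_succ_apply, Function.iterate_succ_apply]
    exact ih ((H a b h hd).1 ε) (by rw [dim_bdT]; omega)

theorem key_aux {n : ℕ} (H : ∀ a b, P.Eqv a b → a.dim < n → P.BdOk a b) (ε ε' : Side) {i : ℕ}
    {a : Term P.Gen} (h : P.BdOk a a) (hd : a.dim ≤ n) (hi : i + 1 < a.dim) :
    P.Eqv (P.bdTo ε' i a) (P.bdTo ε' i (P.bdT ε a)) := by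
  obtain ⟨m, hm⟩ : ∃ m, a.dim = i + 2 + m := ⟨a.dim - (i + 2), by omega⟩
  have e1 : a.dim - i = m + 1 + 1 := by omega
  have e2 : (P.bdT ε a).dim - i = m + 1 := by rw [dim_bdT]; omega
  unfold Sig.bdTo
  rw [e1, e2]
  simp only [Function.iterate_succ_apply]
  have hw := h.1
  have hg := h.2 (by omega) ε'
  refine iterate_aux H ε' m ?_ (by rw [dim_bdT, dim_bdT]; omega)
  cases ε <;> cases ε'
  · exact hg.left
  · exact hg.symm
  · exact hg
  · exact hg.right

theorem bdOk_mk {n : ℕ} (H : ∀ a b, P.Eqv a b → a.dim < n → P.BdOk a b) {a b : Term P.Gen}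
    (hab : P.Eqv a b) (hd : a.dim ≤ n) (h : ∀ ε, P.Eqv (P.bdT ε a) (P.bdT ε b))
    (hb : 2 ≤ b.dim → ∀ ε, P.Eqv (P.bdT ε (P.bdT .src b)) (P.bdT ε (P.bdT .tgt b))) :
    P.BdOk a b := by
  refine ⟨h, fun h2 ε => ?_⟩
  have h3 : ∀ ε', P.Eqv (P.bdT ε (P.bdT ε' a)) (P.bdT ε (P.bdT ε' b)) := fun ε' =>
    (H _ _ (h ε') (by rw [dim_bdT]; omega)).1 ε
  exact (h3 .src).trans ((hb (hab.dim_eq ▸ h2) ε).trans (h3 .tgt).symm)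

theorem BdOk.symm' {n : ℕ} (H : ∀ a b, P.Eqv a b → a.dim < n → P.BdOk a b) {a b : Term P.Gen}
    (hab : P.Eqv a b) (hd : a.dim ≤ n) (h : P.BdOk a b) : P.BdOk b a := by
  have := hab.dim_eq
  exact bdOk_mk H hab.symm (by omega) (fun ε => (h.1 ε).symm) h.2

theorem comp_aux {n : ℕ} (H : ∀ a b, P.Eqv a b → a.dim < n → P.BdOk a b)
    {s s' t t' : Term P.Gen} (hs : P.Eqv s s') (ht : P.Eqv t t') (ps : 0 < s.dim) (pt : 0 < t.dim)
    (c : P.Eqv (P.bdTo .tgt (min s.dim t.dim - 1) s) (P.bdTo .src (min s.dim t.dim - 1) t))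
    (c' : P.Eqv (P.bdTo .tgt (min s'.dim t'.dim - 1) s')
      (P.bdTo .src (min s'.dim t'.dim - 1) t'))
    (ks : P.BdOk s s') (kt : P.BdOk t t') (hd : (Term.comp s t).dim ≤ n) :
    P.BdOk (.comp s t) (.comp s' t') := by
  have ds := hs.dim_eq
  have dt := ht.dim_eq
  simp only [Term.dim] at hd
  have ks' := ks.symm' H hs (by omega)
  have kt' := kt.symm' H ht (by omega)
  have kss : P.BdOk s s := ⟨fun ε => (ks.1 ε).left, ks.2⟩
  have ktt : P.BdOk t t := ⟨fun ε => (kt.1 ε).left, kt.2⟩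
  have kss' : P.BdOk s' s' := ⟨fun ε => (ks'.1 ε).left, ks'.2⟩
  have ktt' : P.BdOk t' t' := ⟨fun ε => (kt'.1 ε).left, kt'.2⟩
  rcases lt_trichotomy s.dim t.dim with h | h | h
  · refine ⟨fun ε => ?_, fun h2 ε => ?_⟩
    · rw [bdT_comp_lt ε h, bdT_comp_lt ε (by omega)]
      have e : min s.dim (P.bdT ε t).dim = min s.dim t.dim := by rw [dim_bdT]; omega
      have e' : min s'.dim (P.bdT ε t').dim = min s'.dim t'.dim := by rw [dim_bdT]; omega
      refine .comp hs (kt.1 ε) ps (by rw [dim_bdT]; omega) ?_ ?_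
      · rw [e]; exact c.trans (key_aux H ε .src ktt (by omega) (by omega))
      · rw [e']; exact c'.trans (key_aux H ε .src ktt' (by omega) (by omega))
    · rw [bdT_comp_lt _ h, bdT_comp_lt _ h]
      have h2 : 2 ≤ t.dim := by omega
      by_cases h3 : s.dim < t.dim - 1
      · rw [bdT_comp_lt _ (by rw [dim_bdT]; omega), bdT_comp_lt _ (by rw [dim_bdT]; omega)]
        have key : ∀ ε', P.Eqv (P.bdTo .tgt (min s.dim (P.bdT ε (P.bdT ε' t)).dim - 1) s)
            (P.bdTo .src (min s.dim (P.bdT ε (P.bdT ε' t)).dim - 1) (P.bdT ε (P.bdT ε' t))) := by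
          intro ε'
          have e : min s.dim (P.bdT ε (P.bdT ε' t)).dim = min s.dim t.dim := by
            rw [dim_bdT, dim_bdT]; omega
          rw [e]
          refine c.trans ((key_aux H ε' .src ktt (by omega) (by omega)).trans ?_)
          have hw := ktt.1 ε'
          exact key_aux H ε .src (H _ _ hw (by rw [dim_bdT]; omega)) (by rw [dim_bdT]; omega)
            (by rw [dim_bdT]; omega)
        exact .comp hs.left (kt.2 h2 ε) ps (by rw [dim_bdT, dim_bdT]; omega) (key _) (key _)
      · have e : ∀ ε', s.dim = (P.bdT ε' t).dim := fun ε' => by rw [dim_bdT]; omega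
        cases ε
        · rw [src_comp_eq (e _), src_comp_eq (e _)]; exact kss.1 _
        · rw [tgt_comp_eq (e _), tgt_comp_eq (e _)]; exact kt.2 h2 _
  · refine ⟨fun ε => ?_, fun h2 ε => ?_⟩
    · cases ε
      · rw [src_comp_eq h, src_comp_eq (by omega)]; exact ks.1 _
      · rw [tgt_comp_eq h, tgt_comp_eq (by omega)]; exact kt.1 _
    · rw [src_comp_eq h, tgt_comp_eq h]
      simp only [Term.dim] at h2
      have e1 : P.bdTo .tgt (min s.dim t.dim - 1) s = P.bdT .tgt s := by
        have : s.dim - (min s.dim t.dim - 1) = 1 := by omega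
        simp [Sig.bdTo, this]
      have e2 : P.bdTo .src (min s.dim t.dim - 1) t = P.bdT .src t := by
        have : t.dim - (min s.dim t.dim - 1) = 1 := by omega
        simp [Sig.bdTo, this]
      rw [e1, e2] at c
      exact (ks.2 (by omega) ε).trans
        (((H _ _ c (by rw [dim_bdT]; omega)).1 ε).trans (kt.2 (by omega) ε))
  · refine ⟨fun ε => ?_, fun h2 ε => ?_⟩
    · rw [bdT_comp_gt ε h, bdT_comp_gt ε (by omega)]
      have e : min (P.bdT ε s).dim t.dim = min s.dim t.dim := by rw [dim_bdT]; omega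
      have e' : min (P.bdT ε s').dim t'.dim = min s'.dim t'.dim := by rw [dim_bdT]; omega
      refine .comp (ks.1 ε) ht (by rw [dim_bdT]; omega) pt ?_ ?_
      · rw [e]; exact (key_aux H ε .tgt kss (by omega) (by omega)).symm.trans c
      · rw [e']; exact (key_aux H ε .tgt kss' (by omega) (by omega)).symm.trans c'
    · rw [bdT_comp_gt _ h, bdT_comp_gt _ h]
      have h2 : 2 ≤ s.dim := by omega
      by_cases h3 : t.dim < s.dim - 1
      · rw [bdT_comp_gt _ (by rw [dim_bdT]; omega), bdT_comp_gt _ (by rw [dim_bdT]; omega)]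
        have key : ∀ ε', P.Eqv
            (P.bdTo .tgt (min (P.bdT ε (P.bdT ε' s)).dim t.dim - 1) (P.bdT ε (P.bdT ε' s)))
            (P.bdTo .src (min (P.bdT ε (P.bdT ε' s)).dim t.dim - 1) t) := by
          intro ε'
          have e : min (P.bdT ε (P.bdT ε' s)).dim t.dim = min s.dim t.dim := by
            rw [dim_bdT, dim_bdT]; omega
          rw [e]
          refine ((key_aux H ε' .tgt kss (by omega) (by omega)).trans ?_).symm.trans c
          have hw := kss.1 ε'
          exact key_aux H ε .tgt (H _ _ hw (by rw [dim_bdT]; omega)) (by rw [dim_bdT]; omega)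
            (by rw [dim_bdT]; omega)
        exact .comp (ks.2 h2 ε) ht.left (by rw [dim_bdT, dim_bdT]; omega) pt (key _) (key _)
      · have e : ∀ ε', (P.bdT ε' s).dim = t.dim := fun ε' => by rw [dim_bdT]; omega
        cases ε
        · rw [src_comp_eq (e _), src_comp_eq (e _)]; exact ks.2 h2 _
        · rw [tgt_comp_eq (e _), tgt_comp_eq (e _)]; exact ktt.1 _

theorem bdOk_aux {n : ℕ} (H : ∀ a b, P.Eqv a b → a.dim < n → P.BdOk a b) :
    ∀ a b, P.Eqv a b → a.dim ≤ n → P.BdOk a b := by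
  intro a b h
  induction h with
  | gen k g =>
    intro hd
    cases k with
    | zero => exact ⟨fun ε => .gen 0 g, fun h2 => absurd h2 (by simp [Term.dim])⟩
    | succ k =>
      refine ⟨fun ε => P.bd_wf ε k g, fun h2 ε => ?_⟩
      cases k with
      | zero => exact absurd h2 (by simp [Term.dim])
      | succ k => exact P.bd_bd ε k g
  | symm h ih =>
    intro hd
    have := h.dim_eq
    exact (ih (by omega)).symm' H h (by omega)
  | trans h h' ih ih' =>
    intro hd
    have := h.dim_eq
    exact ⟨fun ε => ((ih hd).1 ε).trans ((ih' (by omega)).1 ε), (ih hd).2⟩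
  | id h ih =>
    intro hd
    simp only [Term.dim] at hd
    exact ⟨fun ε => h, fun _ ε => ((ih (by omega)).1 ε).left⟩
  | comp hs ht ps pt c c' ihs iht _ _ =>
    intro hd
    have hd' := hd
    simp only [Term.dim] at hd'
    exact comp_aux H hs ht ps pt c c' (ihs (by omega)) (iht (by omega)) hd
  | @id_comp_le s t ht hst c iht _ =>
    intro hd
    have hd' := hd
    simp only [Term.dim] at hd'
    have kt := iht (by omega)
    refine bdOk_mk H (.id_comp_le ht hst c) hd (fun ε => ?_) kt.2
    by_cases h : s.dim + 1 < t.dim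
    · rw [bdT_comp_lt ε (by simpa [Term.dim] using h)]
      refine .id_comp_le (kt.1 ε) (by rw [dim_bdT]; omega) ?_
      exact c.trans (key_aux H ε .src kt (by omega) (by omega))
    · have e : (Term.id s).dim = t.dim := by simp only [Term.dim]; omega
      cases ε
      · rw [src_comp_eq e]
        have : t.dim - s.dim = 1 := by omega
        change P.Eqv s _
        simpa [Sig.bdTo, this] using c
      · rw [tgt_comp_eq e]; exact kt.1 _
  | @id_comp_gt s t h hst ih =>
    intro hd
    have hd' := hd
    simp only [Term.dim] at hd'
    have k := ih (by simp only [Term.dim]; omega)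
    refine bdOk_mk H (.id_comp_gt h hst) hd (fun ε => ?_) (fun _ ε => k.1 ε)
    rw [bdT_comp_gt ε (by simpa [Term.dim] using hst)]
    exact h
  | @comp_id_le s t hs hst c ihs _ =>
    intro hd
    have hd' := hd
    simp only [Term.dim] at hd'
    have ks := ihs (by omega)
    refine bdOk_mk H (.comp_id_le hs hst c) hd (fun ε => ?_) ks.2
    by_cases h : t.dim + 1 < s.dim
    · rw [bdT_comp_gt ε (by simpa [Term.dim] using h)]
      refine .comp_id_le (ks.1 ε) (by rw [dim_bdT]; omega) ?_
      exact (key_aux H ε .tgt ks (by omega) (by omega)).symm.trans c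
    · have e : s.dim = (Term.id t).dim := by simp only [Term.dim]; omega
      cases ε
      · rw [src_comp_eq e]; exact ks.1 _
      · rw [tgt_comp_eq e]
        have : s.dim - t.dim = 1 := by omega
        change P.Eqv t _
        simpa [Sig.bdTo, this] using c.symm
  | @comp_id_gt s t h hst ih =>
    intro hd
    have hd' := hd
    simp only [Term.dim] at hd'
    have k := ih (by simp only [Term.dim]; omega)
    refine bdOk_mk H (.comp_id_gt h hst) hd (fun ε => ?_) (fun _ ε => k.1 ε)
    rw [bdT_comp_lt ε (by simpa [Term.dim] using hst)]
    exact h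
  | @assoc i s t r h1 h2 h3 hl hr ihl ihr =>
    intro hd
    have hd' := hd
    simp only [Term.dim] at hd'
    have kl := ihl hd
    have kr := ihr (by simp only [Term.dim]; omega)
    refine bdOk_mk H (.assoc i h1 h2 h3 hl hr) hd (fun ε => ?_) kr.2
    have wl := kl.1 ε
    have wr := kr.1 ε
    by_cases hs : s.dim = i + 1
    · by_cases ht : t.dim = i + 1
      · by_cases hr' : r.dim = i + 1
        · have e1 : (Term.comp s t).dim = r.dim := by simp only [Term.dim]; omega
          have e2 : s.dim = (Term.comp t r).dim := by simp only [Term.dim]; omega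
          cases ε
          · rw [src_comp_eq e1, src_comp_eq (by omega)] at wl ⊢
            rw [src_comp_eq e2]; exact wl
          · rw [tgt_comp_eq e2, tgt_comp_eq (s := t) (t := r) (by omega)] at wr ⊢
            rw [tgt_comp_eq e1]; exact wr
        · rw [bdT_comp_lt ε (by simp only [Term.dim]; omega)] at wl ⊢
          rw [bdT_comp_lt ε (by simp only [Term.dim]; omega), bdT_comp_lt ε (by omega)] at wr ⊢
          exact .assoc i h1 (by rw [dim_bdT]; omega) (by rw [dim_bdT]; omega) wl wr
      · rw [bdT_comp_gt ε (by simp only [Term.dim]; omega), bdT_comp_lt ε (by omega)] at wl ⊢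
        rw [bdT_comp_lt ε (by simp only [Term.dim]; omega), bdT_comp_gt ε (by omega)] at wr ⊢
        exact .assoc i (by rw [dim_bdT]; omega) (by rw [dim_bdT]; omega) h3 wl wr
    · rw [bdT_comp_gt ε (by simp only [Term.dim]; omega), bdT_comp_gt ε (by omega)] at wl ⊢
      rw [bdT_comp_gt ε (by simp only [Term.dim]; omega)] at wr ⊢
      exact .assoc i (by rw [dim_bdT]; omega) h2 (by rw [dim_bdT]; omega) wl wr
  | @comp_distrib s t r h hl hr ihl ihr =>
    intro hd
    have hd' := hd
    simp only [Term.dim] at hd'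
    have kl := ihl hd
    have kr := ihr (by simp only [Term.dim]; omega)
    refine bdOk_mk H (.comp_distrib h hl hr) hd (fun ε => ?_) kr.2
    have wl := kl.1 ε
    have wr := kr.1 ε
    rw [bdT_comp_lt ε (by simp only [Term.dim]; omega)] at wl ⊢
    rcases lt_trichotomy t.dim r.dim with h' | h' | h'
    · rw [bdT_comp_lt ε h'] at wl ⊢
      rw [bdT_comp_lt ε (by simp only [Term.dim]; omega), bdT_comp_lt ε (by omega)] at wr ⊢
      exact .comp_distrib (by rw [dim_bdT]; omega) wl wr
    · have e1 : (Term.comp s t).dim = (Term.comp s r).dim := by simp only [Term.dim]; omega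
      cases ε
      · rw [src_comp_eq h'] at wl ⊢
        rw [src_comp_eq e1, bdT_comp_lt _ (by omega)]
        exact wl
      · rw [tgt_comp_eq h'] at wl ⊢
        rw [tgt_comp_eq e1, bdT_comp_lt _ (by omega)]
        exact wl
    · rw [bdT_comp_gt ε h'] at wl ⊢
      rw [bdT_comp_gt ε (by simp only [Term.dim]; omega), bdT_comp_lt ε (by omega)] at wr ⊢
      exact .comp_distrib (by rw [dim_bdT]; omega) wl wr
  | @distrib_comp s t r h hl hr ihl ihr =>
    intro hd
    have hd' := hd
    simp only [Term.dim] at hd'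
    have kl := ihl hd
    have kr := ihr (by simp only [Term.dim]; omega)
    refine bdOk_mk H (.distrib_comp h hl hr) hd (fun ε => ?_) kr.2
    have wl := kl.1 ε
    have wr := kr.1 ε
    rw [bdT_comp_gt ε (by simp only [Term.dim]; omega)] at wl ⊢
    rcases lt_trichotomy s.dim t.dim with h' | h' | h'
    · rw [bdT_comp_lt ε h'] at wl ⊢
      rw [bdT_comp_lt ε (by simp only [Term.dim]; omega), bdT_comp_gt ε (by omega)] at wr ⊢
      exact .distrib_comp (by rw [dim_bdT]; omega) wl wr
    · have e1 : (Term.comp s r).dim = (Term.comp t r).dim := by simp only [Term.dim]; omega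
      cases ε
      · rw [src_comp_eq h'] at wl ⊢
        rw [src_comp_eq e1, bdT_comp_gt _ (by omega)]
        exact wl
      · rw [tgt_comp_eq h'] at wl ⊢
        rw [tgt_comp_eq e1, bdT_comp_gt _ (by omega)]
        exact wl
    · rw [bdT_comp_gt ε h'] at wl ⊢
      rw [bdT_comp_gt ε (by simp only [Term.dim]; omega), bdT_comp_gt ε (by omega)] at wr ⊢
      exact .distrib_comp (by rw [dim_bdT]; omega) wl wr

theorem bdOk {a b : Term P.Gen} (h : P.Eqv a b) : P.BdOk a b := by
  have : ∀ n, ∀ a b, P.Eqv a b → a.dim < n → P.BdOk a b := by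
    intro n
    induction n with
    | zero => intro a b _ h; exact absurd h (Nat.not_lt_zero _)
    | succ n ih => intro a b h hd; exact bdOk_aux ih a b h (by omega)
  exact this _ a b h (Nat.lt_succ_self _)

theorem bdT_congr {a b : Term P.Gen} (h : P.Eqv a b) (ε : Side) :
    P.Eqv (P.bdT ε a) (P.bdT ε b) := (bdOk h).1 ε

theorem bdT_bdT {a : Term P.Gen} (h : P.Eqv a a) (h2 : 2 ≤ a.dim) (ε : Side) :
    P.Eqv (P.bdT ε (P.bdT .src a)) (P.bdT ε (P.bdT .tgt a)) := (bdOk h).2 h2 ε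

theorem bdTo_congr {a b : Term P.Gen} (h : P.Eqv a b) (ε : Side) (i : ℕ) :
    P.Eqv (P.bdTo ε i a) (P.bdTo ε i b) := by
  unfold Sig.bdTo
  rw [h.dim_eq]
  exact iterate_aux (n := a.dim + 1) (fun _ _ h _ => bdOk h) ε _ h (Nat.lt_succ_self _)

/-! ### The free precategory on a polygraph -/

variable (P) in
/-- Well-formed expressions up to the congruence. -/
def cellSetoid : Setoid {t : Term P.Gen // P.Eqv t t} where
  r s t := P.Eqv s.1 t.1
  iseqv := ⟨fun t => t.2, fun h => h.symm, fun h h' => h.trans h'⟩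

variable (P) in
/-- The globular set underlying `P^*`: its cells are the well-formed expressions up to the
congruence. -/
def freeGlob : GlobSet.{u} where
  Cell := Quotient P.cellSetoid
  dim := Quotient.lift (fun t => t.1.dim) (fun _ _ h => Eqv.dim_eq h)
  bd ε := Quotient.map (fun t => ⟨P.bdT ε t.1, bdT_congr t.2 ε⟩) (fun _ _ h => bdT_congr h ε)
  bd_of_dim_eq_zero ε x := Quotient.inductionOn x fun t h =>
    Quotient.sound (s := P.cellSetoid) (bdT_congr t.2 ε |>.trans
      ((t.2.bdT_of_dim_eq_zero h ε).symm ▸ t.2))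
  dim_bd ε x := Quotient.inductionOn x fun t => P.dim_bdT ε t.1
  bd_bd ε x := Quotient.inductionOn x fun t h =>
    Quotient.sound (s := P.cellSetoid) (bdT_bdT t.2 h ε)

/-- The cell denoted by a well-formed expression. -/
def mkCell (t : Term P.Gen) (h : P.Eqv t t) : P.freeGlob.Cell := Quotient.mk P.cellSetoid ⟨t, h⟩

theorem mkCell_eq_iff {s t : Term P.Gen} (hs : P.Eqv s s) (ht : P.Eqv t t) :
    mkCell s hs = mkCell t ht ↔ P.Eqv s t :=
  ⟨fun h => Quotient.exact h, fun h => Quotient.sound (s := P.cellSetoid) h⟩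

theorem exists_rep (x : P.freeGlob.Cell) : ∃ t h, x = mkCell (P := P) t h := by
  obtain ⟨⟨t, h⟩, rfl⟩ := Quotient.exists_rep x
  exact ⟨t, h, rfl⟩

/-- A chosen expression denoting a given cell. -/
noncomputable def rep (x : P.freeGlob.Cell) : Term P.Gen := (Quotient.out x).1

theorem rep_wf (x : P.freeGlob.Cell) : P.Eqv (rep x) (rep x) := (Quotient.out x).2

theorem mkCell_rep (x : P.freeGlob.Cell) : mkCell (rep x) (rep_wf x) = x := Quotient.out_eq x

theorem freeGlob_dim (t : Term P.Gen) (h : P.Eqv t t) : P.freeGlob.dim (mkCell t h) = t.dim := rfl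

theorem freeGlob_bd (ε : Side) (t : Term P.Gen) (h : P.Eqv t t) :
    P.freeGlob.bd ε (mkCell t h) = mkCell (P.bdT ε t) (bdT_congr h ε) := rfl

theorem freeGlob_bdTo (ε : Side) (i : ℕ) (t : Term P.Gen) (h : P.Eqv t t) :
    P.freeGlob.bdTo ε i (mkCell t h) = mkCell (P.bdTo ε i t) (bdTo_congr h ε i) := by
  have : ∀ (m : ℕ) (t : Term P.Gen) (h : P.Eqv t t),
      ∃ h', (P.freeGlob.bd ε)^[m] (mkCell t h) = mkCell ((P.bdT ε)^[m] t) h' := by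
    intro m
    induction m with
    | zero => intro t h; exact ⟨h, rfl⟩
    | succ m ih => intro t h; exact ih _ (bdT_congr h ε)
  exact (this _ t h).2

theorem composable_iff {s t : Term P.Gen} (hs : P.Eqv s s) (ht : P.Eqv t t) :
    P.freeGlob.Composable (mkCell s hs) (mkCell t ht) ↔ P.Eqv (.comp s t) (.comp s t) := by
  unfold GlobSet.Composable
  rw [freeGlob_bdTo, freeGlob_bdTo, mkCell_eq_iff]
  simp only [freeGlob_dim]
  exact ⟨fun ⟨h1, h2, h3⟩ => .comp hs ht h1 h2 h3 h3, fun h => h.comp_inv.2.2⟩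

theorem composable_rep {x y : P.freeGlob.Cell} (h : P.freeGlob.Composable x y) :
    P.Eqv (.comp (rep x) (rep y)) (.comp (rep x) (rep y)) := by
  rwa [← composable_iff (rep_wf x) (rep_wf y), mkCell_rep, mkCell_rep]

/-- Composition of the cells of `P^*`, computed on representatives. -/
noncomputable def freeComp (x y : P.freeGlob.Cell) (h : P.freeGlob.Composable x y) :
    P.freeGlob.Cell :=
  mkCell (.comp (rep x) (rep y)) (composable_rep h)

theorem comp_congr {s s' t t' : Term P.Gen} (hs : P.Eqv s s') (ht : P.Eqv t t')
    (h : P.Eqv (.comp s t) (.comp s t)) : P.Eqv (.comp s t) (.comp s' t') := by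
  obtain ⟨_, _, h1, h2, h3⟩ := h.comp_inv
  refine .comp hs ht h1 h2 h3 ?_
  rw [← hs.dim_eq, ← ht.dim_eq]
  exact (bdTo_congr hs _ _).symm.trans (h3.trans (bdTo_congr ht _ _))

theorem freeComp_mk {s t : Term P.Gen} (hs : P.Eqv s s) (ht : P.Eqv t t)
    (h : P.freeGlob.Composable (mkCell s hs) (mkCell t ht)) :
    freeComp (mkCell s hs) (mkCell t ht) h = mkCell (.comp s t) ((composable_iff hs ht).1 h) := by
  refine (mkCell_eq_iff _ _).2 (Eqv.symm ?_)
  refine comp_congr (Eqv.symm ?_) (Eqv.symm ?_) ((composable_iff hs ht).1 h)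
  · exact (mkCell_eq_iff _ _).1 (mkCell_rep (mkCell s hs))
  · exact (mkCell_eq_iff _ _).1 (mkCell_rep (mkCell t ht))

/-- The identity cell on a cell of `P^*`. -/
def freeId : P.freeGlob.Cell → P.freeGlob.Cell :=
  Quotient.map (fun t => ⟨.id t.1, t.2.id⟩) (fun _ _ h => Eqv.id h)

theorem freeId_mk {t : Term P.Gen} (h : P.Eqv t t) : freeId (mkCell t h) = mkCell (.id t) h.id :=
  rfl

variable (P) in
/-- The precategory `P^*` freely generated by the polygraph `P`. -/
noncomputable def free : PreCat.{u} where
  toGlobSet := P.freeGlob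
  id := freeId
  comp := freeComp
  dim_id x := by
    obtain ⟨t, ht, rfl⟩ := exists_rep x
    rfl
  dim_comp x y h := by
    obtain ⟨s, hs, rfl⟩ := exists_rep x
    obtain ⟨t, ht, rfl⟩ := exists_rep y
    rw [freeComp_mk]; rfl
  bd_id ε x := by
    obtain ⟨t, ht, rfl⟩ := exists_rep x
    rfl
  bd_comp_lt ε x y h h' hd := by
    obtain ⟨s, hs, rfl⟩ := exists_rep x
    obtain ⟨t, ht, rfl⟩ := exists_rep y
    simp only [freeGlob_bd] at h' ⊢
    rw [freeComp_mk, freeComp_mk, freeGlob_bd, mkCell_eq_iff]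
    rw [bdT_comp_lt ε hd]
    exact (composable_iff _ _).1 h'
  src_comp_eq x y h hd := by
    obtain ⟨s, hs, rfl⟩ := exists_rep x
    obtain ⟨t, ht, rfl⟩ := exists_rep y
    rw [freeComp_mk, freeGlob_bd, freeGlob_bd, mkCell_eq_iff, Sig.src_comp_eq hd]
    exact bdT_congr hs _
  tgt_comp_eq x y h hd := by
    obtain ⟨s, hs, rfl⟩ := exists_rep x
    obtain ⟨t, ht, rfl⟩ := exists_rep y
    rw [freeComp_mk, freeGlob_bd, freeGlob_bd, mkCell_eq_iff, Sig.tgt_comp_eq hd]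
    exact bdT_congr ht _
  bd_comp_gt ε x y h h' hd := by
    obtain ⟨s, hs, rfl⟩ := exists_rep x
    obtain ⟨t, ht, rfl⟩ := exists_rep y
    simp only [freeGlob_bd] at h' ⊢
    rw [freeComp_mk, freeComp_mk, freeGlob_bd, mkCell_eq_iff]
    rw [bdT_comp_gt ε hd]
    exact (composable_iff _ _).1 h'
  id_comp_le x y h hd := by
    obtain ⟨s, hs, rfl⟩ := exists_rep x
    obtain ⟨t, ht, rfl⟩ := exists_rep y
    simp only [freeId_mk] at h ⊢
    rw [freeComp_mk, mkCell_eq_iff]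
    refine .id_comp_le ht hd ?_
    have c := ((composable_iff _ _).1 h).comp_inv.2.2.2.2
    have hd' : s.dim + 1 ≤ t.dim := hd
    have e : min (Term.id s).dim t.dim - 1 = s.dim := by simp only [Term.dim]; omega
    rw [e] at c
    have e' : P.bdTo .tgt s.dim (.id s) = s := by simp [bdTo, Term.dim, bdT]
    rwa [e'] at c
  id_comp_gt x y h h' hd := by
    obtain ⟨s, hs, rfl⟩ := exists_rep x
    obtain ⟨t, ht, rfl⟩ := exists_rep y
    simp only [freeId_mk] at h ⊢
    simp only [freeComp_mk, freeId_mk]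
    rw [mkCell_eq_iff]
    exact .id_comp_gt ((composable_iff _ _).1 h') hd
  comp_id_le x y h hd := by
    obtain ⟨s, hs, rfl⟩ := exists_rep x
    obtain ⟨t, ht, rfl⟩ := exists_rep y
    simp only [freeId_mk] at h ⊢
    rw [freeComp_mk, mkCell_eq_iff]
    refine .comp_id_le hs hd ?_
    have c := ((composable_iff _ _).1 h).comp_inv.2.2.2.2
    have hd' : t.dim + 1 ≤ s.dim := hd
    have e : min s.dim (Term.id t).dim - 1 = t.dim := by simp only [Term.dim]; omega
    rw [e] at c
    have e' : P.bdTo .src t.dim (.id t) = t := by simp [bdTo, Term.dim, bdT]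
    rwa [e'] at c
  comp_id_gt x y h h' hd := by
    obtain ⟨s, hs, rfl⟩ := exists_rep x
    obtain ⟨t, ht, rfl⟩ := exists_rep y
    simp only [freeId_mk] at h ⊢
    simp only [freeComp_mk, freeId_mk]
    rw [mkCell_eq_iff]
    exact .comp_id_gt ((composable_iff _ _).1 h') hd
  assoc i x y z hxy hyz h h' h1 h2 h3 := by
    obtain ⟨s, hs, rfl⟩ := exists_rep x
    obtain ⟨t, ht, rfl⟩ := exists_rep y
    obtain ⟨r, hr, rfl⟩ := exists_rep z
    simp only [freeComp_mk] at h h' ⊢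
    rw [mkCell_eq_iff]
    exact .assoc i h1 h2 h3 ((composable_iff _ _).1 h) ((composable_iff _ _).1 h')
  comp_distrib x y z hyz h hxy hxz h' hd := by
    obtain ⟨s, hs, rfl⟩ := exists_rep x
    obtain ⟨t, ht, rfl⟩ := exists_rep y
    obtain ⟨r, hr, rfl⟩ := exists_rep z
    simp only [freeComp_mk] at h h' ⊢
    rw [mkCell_eq_iff]
    exact .comp_distrib hd ((composable_iff _ _).1 h) ((composable_iff _ _).1 h')
  distrib_comp x y z hxy h hxz hyz h' hd := by
    obtain ⟨s, hs, rfl⟩ := exists_rep x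
    obtain ⟨t, ht, rfl⟩ := exists_rep y
    obtain ⟨r, hr, rfl⟩ := exists_rep z
    simp only [freeComp_mk] at h h' ⊢
    rw [mkCell_eq_iff]
    exact .distrib_comp hd ((composable_iff _ _).1 h) ((composable_iff _ _).1 h')

/-! ### The category of polygraphs -/

/-- A morphism of polygraphs: maps between the sets of generators that are compatible with the
sources and targets, as cells of the free precategory. -/
@[ext]
structure Hom (P Q : Pol.{u}) where
  app : ∀ k, P.Gen k → Q.Gen k
  map_bd : ∀ ε k (g : P.Gen (k + 1)),
    Q.Eqv ((P.bd ε k g).map app) (Q.bd ε k (app (k + 1) g))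

variable {Q R : Pol.{u}}

theorem map_bdT_aux (F : Hom P Q) {n : ℕ}
    (H : ∀ a, P.Eqv a a → a.dim < n → Q.Eqv (a.map F.app) (a.map F.app)) (ε : Side)
    (a : Term P.Gen) (ha : P.Eqv a a) (ha' : Q.Eqv (a.map F.app) (a.map F.app))
    (hd : a.dim ≤ n) : Q.Eqv ((P.bdT ε a).map F.app) (Q.bdT ε (a.map F.app)) := by
  induction a with
  | gen k g =>
    cases k with
    | zero => exact ha'
    | succ k => exact F.map_bd ε k g
  | id t ih => exact ha'.good.1
  | comp s t ihs iht =>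
    obtain ⟨hs, ht, ps, pt, c⟩ := ha.comp_inv
    obtain ⟨hs', ht', -, -, c'⟩ := Eqv.comp_inv (S := Q.toSig) ha'
    simp only [Term.dim] at hd
    have ks := ihs hs hs' (by omega)
    have kt := iht ht ht' (by omega)
    have hb := bdT_congr ha ε
    have hn : 0 < n := by omega
    have hb' := H _ hb (by rw [dim_bdT]; simp only [Term.dim]; omega)
    have es := Term.dim_map F.app s
    have et := Term.dim_map F.app t
    simp only [Term.map]
    rcases lt_trichotomy s.dim t.dim with h | h | h
    · rw [bdT_comp_lt ε h] at hb' ⊢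
      rw [bdT_comp_lt ε (by omega)]
      exact comp_congr hs' kt hb'
    · cases ε
      · rw [Sig.src_comp_eq h, Sig.src_comp_eq (by omega)]; exact ks
      · rw [Sig.tgt_comp_eq h, Sig.tgt_comp_eq (by omega)]; exact kt
    · rw [bdT_comp_gt ε h] at hb' ⊢
      rw [bdT_comp_gt ε (by omega)]
      exact comp_congr ks ht' hb'

theorem map_bdTo_aux (F : Hom P Q) {n : ℕ}
    (H : ∀ a, P.Eqv a a → a.dim < n → Q.Eqv (a.map F.app) (a.map F.app)) (ε : Side) (i : ℕ)
    (a : Term P.Gen) (ha : P.Eqv a a) (ha' : Q.Eqv (a.map F.app) (a.map F.app))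
    (hd : a.dim ≤ n) : Q.Eqv ((P.bdTo ε i a).map F.app) (Q.bdTo ε i (a.map F.app)) := by
  unfold Sig.bdTo
  rw [Term.dim_map]
  generalize a.dim - i = m
  induction m generalizing a with
  | zero => exact ha'
  | succ m ih =>
    rw [Function.iterate_succ_apply, Function.iterate_succ_apply]
    have k := map_bdT_aux F H ε a ha ha' hd
    have hb := bdT_congr ha ε
    refine (ih _ hb k.left (by rw [dim_bdT]; omega)).trans ?_
    exact iterate_aux (n := ((P.bdT ε a).map F.app).dim + 1) (fun _ _ h _ => bdOk h) ε m k
      (Nat.lt_succ_self _)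

theorem map_eqv_aux (F : Hom P Q) {n : ℕ}
    (H : ∀ a, P.Eqv a a → a.dim < n → Q.Eqv (a.map F.app) (a.map F.app)) :
    ∀ a b, P.Eqv a b → a.dim ≤ n → Q.Eqv (a.map F.app) (b.map F.app) := by
  have D := fun t => Term.dim_map (H := Q.Gen) F.app t
  intro a b h
  induction h with
  | gen k g => intro _; exact .gen _ _
  | symm h ih =>
    intro hd
    have := h.dim_eq
    exact (ih (by omega)).symm
  | trans h _ ih ih' =>
    intro hd
    have := h.dim_eq
    exact (ih hd).trans (ih' (by omega))
  | id _ ih =>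
    intro hd
    simp only [Term.dim] at hd
    exact (ih (by omega)).id
  | @comp s s' t t' hs ht ps pt c c' ihs iht ihc _ =>
    intro hd
    simp only [Term.dim] at hd
    have ks := ihs (by omega)
    have kt := iht (by omega)
    refine comp_congr ks kt ?_
    have hc : Q.Eqv (Q.bdTo .tgt (min s.dim t.dim - 1) (s.map F.app))
        (Q.bdTo .src (min s.dim t.dim - 1) (t.map F.app)) :=
      ((map_bdTo_aux F H _ _ s hs.left ks.left (by omega)).symm.trans
        (ihc (by unfold Sig.bdTo; rw [dim_iterate]; omega))).trans
        (map_bdTo_aux F H _ _ t ht.left kt.left (by omega))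
    rw [← D s, ← D t] at hc
    exact .comp ks.left kt.left (by rw [D]; exact ps) (by rw [D]; exact pt) hc hc
  | @id_comp_le s t ht hst c iht ihc =>
    intro hd
    simp only [Term.dim] at hd
    have kt := iht (by omega)
    refine .id_comp_le kt (by rw [D, D]; exact hst) ?_
    rw [D]
    exact (ihc (by omega)).trans (map_bdTo_aux F H _ _ t ht kt (by omega))
  | @id_comp_gt s t h hst ih =>
    intro hd
    simp only [Term.dim] at hd
    exact .id_comp_gt (ih (by simp only [Term.dim]; omega)) (by rw [D, D]; exact hst)
  | @comp_id_le s t hs hst c ihs ihc =>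
    intro hd
    simp only [Term.dim] at hd
    have ks := ihs (by omega)
    refine .comp_id_le ks (by rw [D, D]; exact hst) ?_
    rw [D]
    exact (map_bdTo_aux F H _ _ s hs ks (by omega)).symm.trans
      (ihc (by unfold Sig.bdTo; rw [dim_iterate]; omega))
  | @comp_id_gt s t h hst ih =>
    intro hd
    simp only [Term.dim] at hd
    exact .comp_id_gt (ih (by simp only [Term.dim]; omega)) (by rw [D, D]; exact hst)
  | assoc i h1 h2 h3 _ _ ihl ihr =>
    intro hd
    exact .assoc i (by rw [D, D]; exact h1) (by rw [D, D]; exact h2) (by rw [D, D]; exact h3)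
      (ihl hd) (ihr (by simp only [Term.dim] at hd ⊢; omega))
  | comp_distrib h _ _ ihl ihr =>
    intro hd
    exact .comp_distrib (by rw [D, D, D]; exact h)
      (ihl hd) (ihr (by simp only [Term.dim] at hd ⊢; omega))
  | distrib_comp h _ _ ihl ihr =>
    intro hd
    exact .distrib_comp (by rw [D, D, D]; exact h)
      (ihl hd) (ihr (by simp only [Term.dim] at hd ⊢; omega))

theorem map_eqv (F : Hom P Q) {a b : Term P.Gen} (h : P.Eqv a b) :
    Q.Eqv (a.map F.app) (b.map F.app) := by
  have : ∀ n, ∀ a, P.Eqv a a → a.dim < n → Q.Eqv (a.map F.app) (a.map F.app) := by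
    intro n
    induction n with
    | zero => intro a _ h; exact absurd h (Nat.not_lt_zero _)
    | succ n ih => intro a h hd; exact map_eqv_aux F ih a a h (by omega)
  exact map_eqv_aux F (this _) a b h le_rfl

theorem map_bdT (F : Hom P Q) (ε : Side) {a : Term P.Gen} (h : P.Eqv a a) :
    Q.Eqv ((P.bdT ε a).map F.app) (Q.bdT ε (a.map F.app)) :=
  map_bdT_aux F (fun _ h _ => map_eqv F h) ε a h (map_eqv F h) le_rfl

instance : Category Pol.{u} where
  Hom P Q := Hom P Q
  id P := ⟨fun _ g => g, fun ε k g => by rw [Term.map_id']; exact P.bd_wf ε k g⟩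
  comp {_ _ _} F G := ⟨fun k g => G.app k (F.app k g), fun ε k g => by
    rw [← Term.map_map]
    exact (map_eqv G (F.map_bd ε k g)).trans (G.map_bd ε k _)⟩

/-- The prefunctor `F^* : P^* ⟶ Q^*` induced by a morphism of polygraphs `F : P ⟶ Q`. -/
noncomputable def freeMap (F : Hom P Q) : PreFunctor P.free Q.free where
  toFun := Quotient.map (fun t => ⟨t.1.map F.app, map_eqv F t.2⟩) (fun _ _ h => map_eqv F h)
  map_dim x := Quotient.inductionOn x fun t => Term.dim_map F.app t.1
  map_bd ε x := Quotient.inductionOn x fun t =>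
    Quotient.sound (s := Q.cellSetoid) (map_bdT F ε t.2)
  map_id x := Quotient.inductionOn x fun _ => rfl
  map_comp x y h h' := by
    obtain ⟨s, hs, rfl⟩ := exists_rep x
    obtain ⟨t, ht, rfl⟩ := exists_rep y
    have e1 : P.free.comp _ _ h = mkCell (.comp s t) ((composable_iff hs ht).1 h) :=
      freeComp_mk hs ht h
    have e2 : Q.free.comp _ _ h' = mkCell (.comp (s.map F.app) (t.map F.app))
        ((composable_iff (map_eqv F hs) (map_eqv F ht)).1 h') :=
      freeComp_mk (map_eqv F hs) (map_eqv F ht) h'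
    rw [e1]
    exact e2.symm

/-- The functor `P ↦ P^*`. -/
noncomputable def freeFunctor : Pol.{u} ⥤ PreCat.{u} where
  obj P := P.free
  map F := freeMap F
  map_id P := PreFunctor.ext (funext fun x => Quotient.inductionOn x fun t =>
    Quotient.sound (s := P.cellSetoid) (by
      change P.Eqv (t.1.map fun _ g => g) t.1
      rw [Term.map_id']; exact t.2))
  map_comp {P Q R} F G := PreFunctor.ext (funext fun x => Quotient.inductionOn x fun t =>
    Quotient.sound (s := R.cellSetoid) (by
      change R.Eqv (t.1.map fun k g => G.app k (F.app k g)) ((t.1.map F.app).map G.app)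
      rw [← Term.map_map]; exact map_eqv G (map_eqv F t.2)))

/-! ### The two concretization functors -/

/-- The functor sending a polygraph to the disjoint union of its sets of generators. With it, the
category of polygraphs is the concrete category `Pol`. -/
def genFunctor : Pol.{u} ⥤ Type u where
  obj P := Σ k, P.Gen k
  map F := TypeCat.ofHom fun g => ⟨g.1, Hom.app F g.1 g.2⟩

/-- The functor sending a polygraph to the disjoint union of the sets of cells of the precategory
that it freely generates. With it, the category of polygraphs is the concrete category `Pol^*`. -/
noncomputable def freeCellFunctor : Pol.{u} ⥤ Type u := freeFunctor ⋙ cellFunctor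

/-- A generator, as a cell of the free precategory. -/
def genCell (g : Σ k, P.Gen k) : P.free.Cell := mkCell (P := P) (.gen g.1 g.2) (.gen g.1 g.2)

/-! ### The support -/

variable (P) in
/-- The support of an expression: the set of the generators occurring in it, in the sources and
targets of these generators, and so on. -/
def suppT : Term P.Gen → Set (Σ k, P.Gen k)
  | .gen 0 g => {⟨0, g⟩}
  | .gen (k + 1) g => {⟨k + 1, g⟩} ∪ suppT (P.bd .src k g) ∪ suppT (P.bd .tgt k g)
  | .id t => suppT t
  | .comp s t => suppT s ∪ suppT t
termination_by t => (t.dim, sizeOf t)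
decreasing_by
  · exact Prod.Lex.left _ _ (by rw [P.dim_bd]; exact Nat.lt_succ_self k)
  · exact Prod.Lex.left _ _ (by rw [P.dim_bd]; exact Nat.lt_succ_self k)
  · exact Prod.Lex.left _ _ (Nat.lt_succ_self _)
  · rcases (le_max_left s.dim t.dim).lt_or_eq with h | h
    · exact Prod.Lex.left _ _ h
    · exact Prod.lex_def.2 (Or.inr ⟨h, by simp only [Term.comp.sizeOf_spec]; omega⟩)
  · rcases (le_max_right s.dim t.dim).lt_or_eq with h | h
    · exact Prod.Lex.left _ _ h
    · exact Prod.lex_def.2 (Or.inr ⟨h, by simp only [Term.comp.sizeOf_spec]; omega⟩)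

theorem suppT_bdT_subset (ε : Side) (t : Term P.Gen) : P.suppT (P.bdT ε t) ⊆ P.suppT t := by
  induction t with
  | gen k g =>
    cases k with
    | zero => exact subset_rfl
    | succ k =>
      rw [suppT, Sig.bdT]
      cases ε
      · exact fun x hx => Or.inl (Or.inr hx)
      · exact fun x hx => Or.inr hx
  | id t ih => rw [suppT, Sig.bdT]
  | comp s t ihs iht =>
    rcases lt_trichotomy s.dim t.dim with h | h | h
    · rw [bdT_comp_lt ε h, suppT, suppT]
      exact Set.union_subset_union_right _ iht
    · cases ε
      · rw [Sig.src_comp_eq h, suppT]; exact ihs.trans Set.subset_union_left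
      · rw [Sig.tgt_comp_eq h, suppT]; exact iht.trans Set.subset_union_right
    · rw [bdT_comp_gt ε h, suppT, suppT]
      exact Set.union_subset_union_left _ ihs

theorem suppT_bdTo_subset (ε : Side) (i : ℕ) (t : Term P.Gen) :
    P.suppT (P.bdTo ε i t) ⊆ P.suppT t := by
  unfold Sig.bdTo
  generalize t.dim - i = m
  induction m generalizing t with
  | zero => exact subset_rfl
  | succ m ih =>
    rw [Function.iterate_succ_apply]
    exact (ih _).trans (suppT_bdT_subset ε t)

theorem suppT_congr {s t : Term P.Gen} (h : P.Eqv s t) : P.suppT s = P.suppT t := by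
  induction h with
  | gen k g => rfl
  | symm _ ih => exact ih.symm
  | trans _ _ ih ih' => exact ih.trans ih'
  | id _ ih => rw [suppT, suppT, ih]
  | comp _ _ _ _ _ _ ihs iht _ _ => rw [suppT, suppT, ihs, iht]
  | id_comp_le _ _ _ _ ih =>
    rw [suppT, suppT, ih]
    exact Set.union_eq_self_of_subset_left (suppT_bdTo_subset _ _ _)
  | id_comp_gt _ _ _ => simp only [suppT]
  | comp_id_le _ _ _ _ ih =>
    rw [suppT, suppT, ← ih]
    exact Set.union_eq_self_of_subset_right (suppT_bdTo_subset _ _ _)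
  | comp_id_gt _ _ _ => simp only [suppT]
  | assoc => simp only [suppT]; exact Set.union_assoc _ _ _
  | comp_distrib => simp only [suppT]; exact Set.union_union_distrib_left _ _ _
  | distrib_comp => simp only [suppT]; exact Set.union_union_distrib_right _ _ _

variable (P) in
/-- The support function of a polygraph. -/
def supp : P.free.Cell → Set (Σ k, P.Gen k) :=
  Quotient.lift (fun t => P.suppT t.1) (fun _ _ h => suppT_congr h)

end Pol

/-! ### Principal elements -/

/-- An element `(X, x)` of a concrete category is principal if every morphism of elements
`(Y, y) ⟶ (X, x)` whose underlying morphism `Y ⟶ X` is a monomorphism is an isomorphism. -/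
def IsPrincipal {C : Type*} [Category C] (F : C ⥤ Type u) (p : F.Elements) : Prop :=
  ∀ (q : F.Elements) (f : q ⟶ p), Mono f.val → IsIso f

end PrecatPol

/-! Two facts reduce the lemma to supports. The support of a cell `x` is closed under passing to
sources and targets of generators, so it spans a subpolygraph whose inclusion is a monomorphism, and
`x` lifts to it. If `x` is principal, this inclusion is an isomorphism, hence bijective on
generators, and the support is everything. Conversely, let `F` be a monomorphism sending some
element to `x`. The support of an image only contains generators in the image of `F`, so full
support of `x` makes `F` surjective on generators. It remains to see that monomorphisms are
injective on generators (`injective_of_mono`) and that bijections on generators are isomorphisms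
(`isIso_of_bijective`).

The lemma that carries all of this is `eqv_of_map_eqv`: an injective map of generators compatible
with boundaries reflects the congruence defining free precategories. The danger is a chain of
congruences in the target passing through expressions outside the image. This cannot happen, because
the congruence preserves supports, and an expression whose support lies in the image of the
generators is itself the image of an expression.

The same argument serves both concretizations, since a generator has the support of the cell that it
denotes. -/

namespace PrecatPol

/-! ### Renaming of generators in formal expressions -/

namespace Term

variable {G H : ℕ → Type u}

theorem map_injective {f : ∀ k, G k → H k} (hf : ∀ k, Function.Injective (f k)) :
    Function.Injective (map f) := by
  intro s
  induction s with
  | gen k g =>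
    intro t h
    cases t with
    | gen l g' =>
      simp only [map, gen.injEq] at h
      obtain ⟨rfl, h⟩ := h
      rw [hf _ (eq_of_heq h)]
    | id t => cases h
    | comp t t' => cases h
  | id s ih =>
    intro t h
    cases t with
    | gen l g' => cases h
    | id t => rw [ih (id.inj h)]
    | comp t t' => cases h
  | comp s s' ih ih' =>
    intro t h
    cases t with
    | gen l g' => cases h
    | id t => cases h
    | comp t t' => rw [ih (comp.inj h).1, ih' (comp.inj h).2]

/-- Two renamings agree on an expression if they agree in all dimensions up to its own. -/
theorem map_congr_of_dim_le {f f' : ∀ k, G k → H k} {n : ℕ} (h : ∀ k ≤ n, f k = f' k)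
    (t : Term G) (ht : t.dim ≤ n) : t.map f = t.map f' := by
  induction t with
  | gen k g => simp only [map]; rw [h k ht]
  | id t ih => simp only [dim] at ht; simp only [map]; rw [ih (by omega)]
  | comp s t ihs iht =>
    simp only [dim] at ht; simp only [map]; rw [ihs (by omega), iht (by omega)]

end Term

namespace Pol

open Sig

variable {P Q : Pol.{u}}

/-! ### Supports of expressions: transitivity and dimension -/

/-- The map on the disjoint union of the sets of generators induced by a family of maps. -/
def totalMap {G H : ℕ → Type u} (f : ∀ k, G k → H k) (x : Σ k, G k) : Σ k, H k := ⟨x.1, f x.1 x.2⟩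

theorem mem_suppT_gen (k : ℕ) (g : P.Gen k) : (⟨k, g⟩ : Σ k, P.Gen k) ∈ P.suppT (.gen k g) := by
  cases k with
  | zero => rw [suppT]; rfl
  | succ k => rw [suppT]; exact Or.inl (Or.inl rfl)

theorem suppT_bd_subset (ε : Side) (k : ℕ) (g : P.Gen (k + 1)) :
    P.suppT (P.bd ε k g) ⊆ P.suppT (.gen (k + 1) g) :=
  suppT_bdT_subset ε (.gen (k + 1) g)

/-- Induction on the expressions of a polygraph, where the sources and targets of the generators
come before these generators. -/
theorem term_induction {motive : Term P.Gen → Prop}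
    (gen_zero : ∀ g, motive (.gen 0 g))
    (gen_succ : ∀ k g, (∀ ε, motive (P.bd ε k g)) → motive (.gen (k + 1) g))
    (id : ∀ t, motive t → motive (.id t))
    (comp : ∀ s t, motive s → motive t → motive (.comp s t)) (t : Term P.Gen) : motive t := by
  have aux : ∀ n, ∀ t : Term P.Gen, t.dim < n → motive t := by
    intro n
    induction n with
    | zero => intro t h; exact absurd h (Nat.not_lt_zero _)
    | succ n ih =>
      intro t
      induction t with
      | gen k g =>
        intro hd
        cases k with
        | zero => exact gen_zero g
        | succ k =>
          exact gen_succ k g fun ε => ih _ (by rw [P.dim_bd]; simp only [Term.dim] at hd; omega)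
      | id t iht => intro hd; simp only [Term.dim] at hd; exact id t (iht (by omega))
      | comp s t ihs iht =>
        intro hd
        simp only [Term.dim] at hd
        exact comp s t (ihs (by omega)) (iht (by omega))
  exact aux _ t (Nat.lt_succ_self _)

/-- Transitivity of the relation "occurs in the support of". This is what makes supports closed sets
of generators. -/
theorem suppT_gen_subset {x : Σ k, P.Gen k} {t : Term P.Gen} (h : x ∈ P.suppT t) :
    P.suppT (.gen x.1 x.2) ⊆ P.suppT t := by
  induction t using term_induction with
  | gen_zero g => rw [suppT, Set.mem_singleton_iff] at h; rw [h]
  | gen_succ k g ih =>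
    rw [suppT] at h
    rcases h with (h | h) | h
    · rw [Set.mem_singleton_iff] at h; rw [h]
    · exact (ih .src h).trans (suppT_bd_subset _ _ _)
    · exact (ih .tgt h).trans (suppT_bd_subset _ _ _)
  | id t ih => rw [suppT] at h ⊢; exact ih h
  | comp s t ihs iht =>
    rw [suppT] at h ⊢
    rcases h with h | h
    · exact (ihs h).trans Set.subset_union_left
    · exact (iht h).trans Set.subset_union_right

/-- Needed to truncate polygraphs: the boundary of a generator only involves generators of strictly
smaller dimension. -/
theorem dim_le_of_mem_suppT {x : Σ k, P.Gen k} {t : Term P.Gen} (h : x ∈ P.suppT t) :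
    x.1 ≤ t.dim := by
  induction t using term_induction with
  | gen_zero g => rw [suppT, Set.mem_singleton_iff] at h; rw [h]; rfl
  | gen_succ k g ih =>
    rw [suppT] at h
    simp only [Term.dim]
    rcases h with (h | h) | h
    · rw [Set.mem_singleton_iff] at h; rw [h]
    · have := ih .src h; rw [P.dim_bd] at this; omega
    · have := ih .tgt h; rw [P.dim_bd] at this; omega
  | id t ih => rw [suppT] at h; simp only [Term.dim]; have := ih h; omega
  | comp s t ihs iht =>
    rw [suppT] at h
    simp only [Term.dim]
    rcases h with h | h
    · have := ihs h; omega
    · have := iht h; omega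

/-! ### Expressions over a family of generators mapped to a polygraph -/

/-- Only the generators written in `t` have to be lifted, and they all belong to its support. The
lift is a literal equality of expressions; no boundary of the family `G` is involved. -/
theorem exists_map_eq {G : ℕ → Type u} {f : ∀ k, G k → P.Gen k} {t : Term P.Gen}
    (h : P.suppT t ⊆ Set.range (totalMap f)) : ∃ s : Term G, s.map f = t := by
  induction t with
  | gen k g =>
    obtain ⟨⟨l, g'⟩, e⟩ := h (mem_suppT_gen k g)
    simp only [totalMap, Sigma.mk.injEq] at e
    obtain ⟨rfl, e⟩ := e
    exact ⟨.gen l g', by rw [Term.map, eq_of_heq e]⟩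
  | id t ih =>
    rw [suppT] at h
    obtain ⟨s, rfl⟩ := ih h
    exact ⟨.id s, rfl⟩
  | comp t t' ih ih' =>
    rw [suppT, Set.union_subset_iff] at h
    obtain ⟨s, rfl⟩ := ih h.1
    obtain ⟨s', rfl⟩ := ih' h.2
    exact ⟨.comp s s', rfl⟩

/-! ### Reflection of the congruence along injective maps of generators -/

section Reflect

variable {S : Sig.{u}} {f : ∀ k, S.Gen k → P.Gen k}
  (hbd : ∀ ε k g, P.Eqv ((S.bd ε k g).map f) (P.bd ε k (f (k + 1) g)))

-- Here `S` is a bare signature, with no polygraph axioms assumed, so the induction on dimension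
-- draws on `P` for the dimension of boundaries. The boundary of `f g` is only congruent to the
-- image of the boundary of `g`, which suffices because congruent expressions have equal supports.
include hbd in
theorem suppT_map_subset_range (s : Term S.Gen) :
    P.suppT (s.map f) ⊆ Set.range (totalMap f) := by
  have aux : ∀ n, ∀ s : Term S.Gen, s.dim < n → P.suppT (s.map f) ⊆ Set.range (totalMap f) := by
    intro n
    induction n with
    | zero => intro s h; exact absurd h (Nat.not_lt_zero _)
    | succ n ih =>
      intro s
      induction s with
      | gen k g =>
        intro hd
        cases k with
        | zero => rw [Term.map, suppT]; rintro _ rfl; exact ⟨⟨0, g⟩, rfl⟩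
        | succ k =>
          have key : ∀ ε, P.suppT (P.bd ε k (f (k + 1) g)) ⊆ Set.range (totalMap f) := by
            intro ε
            rw [← suppT_congr (hbd ε k g)]
            refine ih _ ?_
            have := (hbd ε k g).dim_eq
            rw [Term.dim_map, P.dim_bd] at this
            simp only [Term.dim] at hd
            omega
          rw [Term.map, suppT]
          refine Set.union_subset (Set.union_subset ?_ (key .src)) (key .tgt)
          rintro _ rfl
          exact ⟨⟨k + 1, g⟩, rfl⟩
      | id t iht =>
        intro hd; simp only [Term.dim] at hd
        rw [Term.map, suppT]; exact iht (by omega)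
      | comp s t ihs iht =>
        intro hd; simp only [Term.dim] at hd
        rw [Term.map, suppT]
        exact Set.union_subset (ihs (by omega)) (iht (by omega))
  exact aux _ s (Nat.lt_succ_self _)

-- Unlike `map_bdT`, this asks for well-formedness of the image in `P` only, so it is available
-- before anything is known about the congruence of `S`.
include hbd in
theorem map_bdT_of_map_bd (ε : Side) (s : Term S.Gen) (h : P.Eqv (s.map f) (s.map f)) :
    P.Eqv ((S.bdT ε s).map f) (P.bdT ε (s.map f)) := by
  induction s with
  | gen k g =>
    cases k with
    | zero => exact .gen _ _
    | succ k => exact hbd ε k g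
  | id t _ => exact h.good.1
  | comp s t ihs iht =>
    obtain ⟨hs, ht, -⟩ := Eqv.comp_inv (S := P.toSig) h
    have hb := bdT_congr h ε
    have es := Term.dim_map f s
    have et := Term.dim_map f t
    simp only [Term.map] at hb ⊢
    rcases lt_trichotomy s.dim t.dim with hd | hd | hd
    · rw [bdT_comp_lt ε (by omega)] at hb
      rw [bdT_comp_lt ε hd, bdT_comp_lt ε (by omega)]
      exact (comp_congr hs (iht ht).symm hb).symm
    · cases ε
      · rw [Sig.src_comp_eq hd, Sig.src_comp_eq (by omega)]; exact ihs hs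
      · rw [Sig.tgt_comp_eq hd, Sig.tgt_comp_eq (by omega)]; exact iht ht
    · rw [bdT_comp_gt ε (by omega)] at hb
      rw [bdT_comp_gt ε hd, bdT_comp_gt ε (by omega)]
      exact (comp_congr (ihs hs).symm ht hb).symm

include hbd in
theorem map_bdTo_of_map_bd (ε : Side) (i : ℕ) (s : Term S.Gen) (h : P.Eqv (s.map f) (s.map f)) :
    P.Eqv ((S.bdTo ε i s).map f) (P.bdTo ε i (s.map f)) := by
  unfold Sig.bdTo
  rw [Term.dim_map]
  generalize s.dim - i = m
  induction m generalizing s with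
  | zero => exact h
  | succ m ih =>
    rw [Function.iterate_succ_apply, Function.iterate_succ_apply]
    have k := map_bdT_of_map_bd hbd ε s h
    refine (ih _ k.left).trans ?_
    exact iterate_aux (n := ((S.bdT ε s).map f).dim + 1) (fun _ _ h _ => bdOk h) ε m k
      (Nat.lt_succ_self _)

-- Every rule deriving a congruence in `P` is replayed in `S`. The expressions in the rule lift by
-- injectivity of `map f`. The boundary side conditions are different: a boundary in `P` of an image
-- is merely congruent to the image of a boundary, so the induction on derivations does not apply to
-- them. They live in dimension `< n`, and are handled by the hypothesis `H`.
include hbd in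
theorem eqv_of_map_eqv_aux (hf : ∀ k, Function.Injective (f k)) {n : ℕ}
    (H : ∀ s t : Term S.Gen, P.Eqv (s.map f) (t.map f) → s.dim < n → S.Eqv s t) :
    ∀ a b, P.Eqv a b → a.dim ≤ n → ∀ s t : Term S.Gen, s.map f = a → t.map f = b → S.Eqv s t := by
  have D := Term.dim_map f
  have I := Term.map_injective hf
  have key : ∀ ε ε' i (s t : Term S.Gen), P.Eqv (s.map f) (s.map f) → P.Eqv (t.map f) (t.map f) →
      P.Eqv (P.bdTo ε i (s.map f)) (P.bdTo ε' i (t.map f)) →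
      i < n → i ≤ s.dim → S.Eqv (S.bdTo ε i s) (S.bdTo ε' i t) := by
    intro ε ε' i s t hs ht h hi hi'
    have ks := map_bdTo_of_map_bd hbd ε i s hs
    refine H _ _ (ks.trans (h.trans (map_bdTo_of_map_bd hbd ε' i t ht).symm)) ?_
    -- As `S` need not satisfy the axioms of polygraphs, the dimension of its iterated boundary,
    -- namely `i`, is read off from the congruent expression in `P`.
    have e := ks.dim_eq
    unfold Sig.bdTo at e ⊢
    rw [D, dim_iterate, D] at e
    omega
  -- Renaming preserves the outermost constructor, so the shape of a rule in `P` lifts to `S`.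
  have cut : ∀ (s : Term S.Gen) (x y : Term P.Gen), s.map f = .comp x y →
      ∃ s₁ s₂, s = .comp s₁ s₂ ∧ s₁.map f = x ∧ s₂.map f = y := by
    intro s x y h
    cases s with
    | gen k g => cases h
    | id s => cases h
    | comp s₁ s₂ => exact ⟨s₁, s₂, rfl, (Term.comp.inj h).1, (Term.comp.inj h).2⟩
  have cut' : ∀ (s : Term S.Gen) (x : Term P.Gen), s.map f = .id x →
      ∃ s₁, s = .id s₁ ∧ s₁.map f = x := by
    intro s x h
    cases s with
    | gen k g => cases h
    | id s => exact ⟨s, rfl, Term.id.inj h⟩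
    | comp s₁ s₂ => cases h
  intro a b h
  induction h with
  | gen k g =>
    intro _ s t hs ht
    obtain rfl := I (hs.trans ht.symm)
    cases s with
    | gen l g' => exact .gen _ _
    | id s => cases hs
    | comp s₁ s₂ => cases hs
  | symm h ih =>
    intro hd s t hs ht
    have := h.dim_eq
    exact (ih (by omega) t s ht hs).symm
  | trans h _ ih ih' =>
    intro hd s t hs ht
    have e := h.dim_eq
    -- The crucial case: the middle expression is not given as an image, but its support is that of
    -- the image of `s`, hence it lifts.
    obtain ⟨r, hr⟩ : ∃ r : Term S.Gen, r.map f = _ := exists_map_eq (by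
      rw [← suppT_congr h, ← hs]; exact suppT_map_subset_range hbd s)
    exact (ih hd s r hs hr).trans (ih' (by omega) r t hr ht)
  | id _ ih =>
    intro hd s t hs ht
    simp only [Term.dim] at hd
    obtain ⟨s, rfl, hs'⟩ := cut' _ _ hs
    obtain ⟨t, rfl, ht'⟩ := cut' _ _ ht
    exact (ih (by omega) s t hs' ht').id
  | comp h h' p p' c c' ih ih' _ _ =>
    intro hd s t hs ht
    simp only [Term.dim] at hd
    obtain ⟨s, s', rfl, rfl, rfl⟩ := cut _ _ _ hs
    obtain ⟨t, t', rfl, rfl, rfl⟩ := cut _ _ _ ht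
    have e := h.dim_eq
    have e' := h'.dim_eq
    simp only [D] at *
    exact .comp (ih (by omega) s t rfl rfl) (ih' (by omega) s' t' rfl rfl) p p'
      (key _ _ _ _ _ h.left h'.left c (by omega) (by omega))
      (key _ _ _ _ _ h.right h'.right c' (by omega) (by omega))
  | id_comp_le h hst c ih _ =>
    intro hd s t hs ht
    simp only [Term.dim] at hd
    obtain ⟨s, s', rfl, hs', rfl⟩ := cut _ _ _ hs
    obtain ⟨s, rfl, rfl⟩ := cut' _ _ hs'
    obtain rfl := I ht
    simp only [D] at *
    -- The identity is on a cell of dimension `s.dim < t.dim ≤ n`, so `H` reflects the condition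
    -- that `s` is the iterated source of `t`.
    have c₁ := map_bdTo_of_map_bd hbd .src s.dim t h
    exact .id_comp_le (ih (by omega) t t rfl rfl) hst (H _ _ (c.trans c₁.symm) (by omega))
  | id_comp_gt _ hst ih =>
    intro hd s t hs ht
    simp only [Term.dim] at hd
    obtain ⟨s, s', rfl, hs', rfl⟩ := cut _ _ _ hs
    obtain ⟨s, rfl, rfl⟩ := cut' _ _ hs'
    obtain ⟨t, rfl, ht'⟩ := cut' _ _ ht
    obtain rfl := I (a₁ := t) (a₂ := .comp s s') ht'
    simp only [D] at *
    exact .id_comp_gt (ih (by simp only [Term.dim, Term.dim_map]; omega) _ _ rfl rfl) hst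
  | comp_id_le h hst c ih _ =>
    intro hd s t hs ht
    simp only [Term.dim] at hd
    obtain ⟨s, s', rfl, rfl, hs'⟩ := cut _ _ _ hs
    obtain ⟨s', rfl, rfl⟩ := cut' _ _ hs'
    obtain rfl := I ht
    simp only [D] at *
    have c₁ := map_bdTo_of_map_bd hbd .tgt s'.dim t h
    exact .comp_id_le (ih (by omega) t t rfl rfl) hst (H _ _ (c.symm.trans c₁.symm) (by omega)).symm
  | comp_id_gt _ hst ih =>
    intro hd s t hs ht
    simp only [Term.dim] at hd
    obtain ⟨s, s', rfl, rfl, hs'⟩ := cut _ _ _ hs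
    obtain ⟨s', rfl, rfl⟩ := cut' _ _ hs'
    obtain ⟨t, rfl, ht'⟩ := cut' _ _ ht
    obtain rfl := I (a₁ := t) (a₂ := .comp s s') ht'
    simp only [D] at *
    exact .comp_id_gt (ih (by simp only [Term.dim, Term.dim_map]; omega) _ _ rfl rfl) hst
  | assoc i h1 h2 h3 _ _ ihl ihr =>
    intro hd s t hs ht
    obtain ⟨s, s₃, rfl, hs', rfl⟩ := cut _ _ _ hs
    obtain ⟨s₁, s₂, rfl, rfl, rfl⟩ := cut _ _ _ hs'
    obtain rfl := I (a₁ := t) (a₂ := .comp s₁ (.comp s₂ s₃)) ht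
    simp only [D] at *
    exact .assoc i h1 h2 h3 (ihl hd _ _ rfl rfl)
      (ihr (by simp only [Term.dim] at hd ⊢; omega) _ _ rfl rfl)
  | comp_distrib hst _ _ ihl ihr =>
    intro hd s t hs ht
    obtain ⟨s₁, s, rfl, rfl, hs'⟩ := cut _ _ _ hs
    obtain ⟨s₂, s₃, rfl, rfl, rfl⟩ := cut _ _ _ hs'
    obtain rfl := I (a₁ := t) (a₂ := .comp (.comp s₁ s₂) (.comp s₁ s₃)) ht
    simp only [D] at *
    exact .comp_distrib hst (ihl hd _ _ rfl rfl)
      (ihr (by simp only [Term.dim] at hd ⊢; omega) _ _ rfl rfl)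
  | distrib_comp hst _ _ ihl ihr =>
    intro hd s t hs ht
    obtain ⟨s, s₃, rfl, hs', rfl⟩ := cut _ _ _ hs
    obtain ⟨s₁, s₂, rfl, rfl, rfl⟩ := cut _ _ _ hs'
    obtain rfl := I (a₁ := t) (a₂ := .comp (.comp s₁ s₃) (.comp s₂ s₃)) ht
    simp only [D] at *
    exact .distrib_comp hst (ihl hd _ _ rfl rfl)
      (ihr (by simp only [Term.dim] at hd ⊢; omega) _ _ rfl rfl)

include hbd in
/-- An injective map of generators that is compatible with the boundaries reflects the
congruence. -/
theorem eqv_of_map_eqv (hf : ∀ k, Function.Injective (f k)) {s t : Term S.Gen}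
    (h : P.Eqv (s.map f) (t.map f)) : S.Eqv s t := by
  have : ∀ n, ∀ s t : Term S.Gen, P.Eqv (s.map f) (t.map f) → s.dim < n → S.Eqv s t := by
    intro n
    induction n with
    | zero => intro s t _ h; exact absurd h (Nat.not_lt_zero _)
    | succ n ih =>
      intro s t h hd
      exact eqv_of_map_eqv_aux hbd hf ih _ _ h (by rw [Term.dim_map]; omega) s t rfl rfl
  exact this _ s t h (Nat.lt_succ_self _)

end Reflect

/-! ### Subpolygraphs -/

/-- A set of generators is closed if it contains the supports of the sources and of the targets of
its elements. -/
def IsClosedSet (A : Set (Σ k, P.Gen k)) : Prop :=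
  ∀ ε k (g : P.Gen (k + 1)), ⟨k + 1, g⟩ ∈ A → P.suppT (P.bd ε k g) ⊆ A

/-- The support of a generator contains those of its boundaries, and transitivity puts it inside the
support of `t`. -/
theorem isClosedSet_suppT (t : Term P.Gen) : IsClosedSet (P.suppT t) := fun ε k g h =>
  (suppT_bd_subset ε k g).trans (suppT_gen_subset h)

theorem isClosedSet_dim_lt (n : ℕ) : IsClosedSet {x : Σ k, P.Gen k | x.1 < n} := by
  intro ε k g h x hx
  have := dim_le_of_mem_suppT hx
  rw [P.dim_bd] at this
  exact this.trans_lt ((Nat.lt_succ_self k).trans h)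

/-- The generators in a given set. -/
def subGen (A : Set (Σ k, P.Gen k)) (k : ℕ) : Type u := {g : P.Gen k // ⟨k, g⟩ ∈ A}

/-- The inclusion of the generators in a given set. -/
def subVal (A : Set (Σ k, P.Gen k)) (k : ℕ) (g : subGen A k) : P.Gen k := g.1

theorem subVal_injective (A : Set (Σ k, P.Gen k)) (k : ℕ) : Function.Injective (subVal A k) :=
  Subtype.val_injective

theorem range_totalMap_subVal (A : Set (Σ k, P.Gen k)) : Set.range (totalMap (subVal A)) = A :=
  Set.Subset.antisymm (by rintro _ ⟨x, rfl⟩; exact x.2.2) fun x hx => ⟨⟨x.1, x.2, hx⟩, rfl⟩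

theorem exists_map_subVal_eq {A : Set (Σ k, P.Gen k)} {t : Term P.Gen} (h : P.suppT t ⊆ A) :
    ∃ s : Term (subGen A), s.map (subVal A) = t :=
  exists_map_eq (by rwa [range_totalMap_subVal])

/-- The signature consisting of the generators in a closed set. -/
noncomputable abbrev subSig {A : Set (Σ k, P.Gen k)} (hA : IsClosedSet A) : Sig.{u} where
  Gen := subGen A
  -- The chosen boundary expressions of `P` are lifted themselves, so the inclusion respects them on
  -- the nose and not just up to congruence.
  bd ε k g := (exists_map_subVal_eq (hA ε k g.1 g.2)).choose

theorem map_subSig_bd {A : Set (Σ k, P.Gen k)} (hA : IsClosedSet A) (ε : Side) (k : ℕ)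
    (g : subGen A (k + 1)) : ((subSig hA).bd ε k g).map (subVal A) = P.bd ε k g.1 :=
  (exists_map_subVal_eq (hA ε k g.1 g.2)).choose_spec

theorem subSig_map_bd {A : Set (Σ k, P.Gen k)} (hA : IsClosedSet A) (ε : Side) (k : ℕ)
    (g : subGen A (k + 1)) :
    P.Eqv (((subSig hA).bd ε k g).map (subVal A)) (P.bd ε k (subVal A (k + 1) g)) := by
  rw [map_subSig_bd]; exact P.bd_wf ε k g.1

theorem subSig_eqv {A : Set (Σ k, P.Gen k)} (hA : IsClosedSet A) {s t : Term (subGen A)}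
    (h : P.Eqv (s.map (subVal A)) (t.map (subVal A))) : (subSig hA).Eqv s t :=
  eqv_of_map_eqv (S := subSig hA) (subSig_map_bd hA) (subVal_injective A) h

/-- The subpolygraph on a closed set of generators. -/
noncomputable abbrev sub {A : Set (Σ k, P.Gen k)} (hA : IsClosedSet A) : Pol.{u} where
  toSig := subSig hA
  -- Reflection was established for bare signatures, so it can be used to pull the well-formedness
  -- and globularity of boundaries back from `P`.
  bd_wf ε k g := subSig_eqv hA (by rw [map_subSig_bd]; exact P.bd_wf ε k g.1)
  dim_bd ε k g := by
    rw [← Term.dim_map (subVal A), map_subSig_bd, P.dim_bd]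
  bd_bd ε k g := by
    refine subSig_eqv hA ?_
    have key : ∀ ε', P.Eqv (((subSig hA).bdT ε ((subSig hA).bd ε' (k + 1) g)).map (subVal A))
        (P.bdT ε (P.bd ε' (k + 1) g.1)) := by
      intro ε'
      have := map_bdT_of_map_bd (S := subSig hA) (subSig_map_bd hA) ε
        ((subSig hA).bd ε' (k + 1) g) (by rw [map_subSig_bd]; exact P.bd_wf ε' (k + 1) g.1)
      rwa [map_subSig_bd] at this
    exact (key .src).trans ((P.bd_bd ε k g.1).trans (key .tgt).symm)

/-- The inclusion of a subpolygraph. -/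
noncomputable def subIncl {A : Set (Σ k, P.Gen k)} (hA : IsClosedSet A) : sub hA ⟶ P where
  app := subVal A
  map_bd := subSig_map_bd hA

/-! ### Monomorphisms and isomorphisms of polygraphs -/

theorem mono_of_injective (F : P ⟶ Q) (hF : ∀ k, Function.Injective (Hom.app F k)) : Mono F := by
  refine ⟨fun G H h => Hom.ext (funext fun k => funext fun x => hF k ?_)⟩
  exact congrFun (congrFun (congrArg Hom.app h) k) x

/-- Suppose `F` identifies two `k`-generators `g` and `h`. By induction `F` is injective below
dimension `k`, so it reflects the congruence there, and `g` and `h` already have the same source and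
target in `P`. Hence the truncation of `P` to dimensions at most `k` has, besides its inclusion,
another morphism to `P` that sends `g` to `h` and fixes all other generators. Both agree after
composition with `F`, so they are equal and `g = h`. -/
theorem injective_of_mono (F : P ⟶ Q) [Mono F] (k : ℕ) : Function.Injective (Hom.app F k) := by
  classical
  induction k using Nat.strong_induction_on with
  | _ k ih =>
  intro g h hgh
  have hbd : ∀ ε l (hl : l + 1 = k), P.Eqv (P.bd ε l (hl ▸ g)) (P.bd ε l (hl ▸ h)) := by
    rintro ε l rfl
    have hA := isClosedSet_dim_lt (P := P) (l + 1)
    have key : ∀ x : P.Gen (l + 1), ∃ s : Term (subGen {x : Σ k, P.Gen k | x.1 < l + 1}),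
        s.map (subVal _) = P.bd ε l x := fun x => exists_map_subVal_eq fun y hy => by
      have := dim_le_of_mem_suppT hy
      rw [P.dim_bd] at this
      exact Nat.lt_succ_of_le this
    obtain ⟨s, hs⟩ := key g
    obtain ⟨t, ht⟩ := key h
    -- The boundaries are compared in the truncation to dimensions `< l + 1`, on which the composite
    -- with `F` is injective by induction.
    have e : (sub hA).Eqv s t := by
      refine eqv_of_map_eqv (S := (sub hA).toSig) (Hom.map_bd (subIncl hA ≫ F)) ?_ ?_
      · rintro i ⟨x, hx⟩ ⟨y, hy⟩ hxy
        exact Subtype.ext (ih i hx hxy)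
      · change Q.Eqv (s.map fun k x => Hom.app F k (subVal _ k x))
          (t.map fun k x => Hom.app F k (subVal _ k x))
        rw [← Term.map_map (subVal _) (Hom.app F) s, ← Term.map_map (subVal _) (Hom.app F) t, hs, ht]
        refine (Hom.map_bd F ε l g).trans ?_
        rw [hgh]
        exact (Hom.map_bd F ε l h).symm
    have := map_eqv (subIncl hA) e
    change P.Eqv (s.map (subVal _)) (t.map (subVal _)) at this
    rwa [hs, ht] at this
  have hA := isClosedSet_dim_lt (P := P) (k + 1)
  -- Not a transposition: `g` is sent to `h`, and `h` stays fixed. Generators above dimension `k`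
  -- are cut off, since their boundaries may involve `g` and would be altered by this map.
  let swap : ∀ i, subGen {x : Σ k, P.Gen k | x.1 < k + 1} i → P.Gen i := fun i x =>
    if hi : i = k then if hi ▸ x.1 = g then hi ▸ h else x.1 else x.1
  have swap_lt : ∀ i < k, swap i = subVal _ i := fun i hi => by
    funext x; simp only [swap]; rw [dif_neg hi.ne]; rfl
  let G : sub hA ⟶ P :=
    { app := swap
      map_bd := fun ε l x => by
        have hl : l < k := Nat.lt_of_succ_lt_succ x.2
        -- Boundaries of generators of the truncation lie in dimension `l < k`, where the map is the
        -- inclusion.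
        have e : ((sub hA).bd ε l x).map swap = P.bd ε l x.1 := by
          refine Eq.trans ?_ (map_subSig_bd hA ε l x)
          exact Term.map_congr_of_dim_le (n := l) (fun i hi => swap_lt i (by omega)) _
            ((sub hA).dim_bd ε l x).le
        change P.Eqv (((sub hA).bd ε l x).map swap) _
        rw [e]
        by_cases hlk : l + 1 = k
        · subst hlk
          simp only [swap, dif_pos]
          split_ifs with hx
          · rw [hx]; exact hbd ε l rfl
          · exact P.bd_wf ε l x.1
        · simp only [swap]
          rw [dif_neg hlk]
          exact P.bd_wf ε l x.1 }
  have hG : subIncl hA ≫ F = G ≫ F := by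
    refine Hom.ext (funext fun i => funext fun x => ?_)
    change Hom.app F i x.1 = Hom.app F i (swap i x)
    by_cases hi : i = k
    · subst hi
      simp only [swap, dif_pos]
      split_ifs with hx
      · rw [hx]; exact hgh
      · rfl
    · simp only [swap]; rw [dif_neg hi]
  have := congrFun (congrFun (congrArg Hom.app ((cancel_mono F).1 hG)) k)
    (⟨g, Nat.lt_succ_self k⟩ : subGen {x : Σ k, P.Gen k | x.1 < k + 1} k)
  change g = swap k ⟨g, _⟩ at this
  simpa [swap] using this

/-- The inverse maps respect sources and targets because this can be checked after applying `F`,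
which reflects the congruence. -/
theorem isIso_of_bijective (F : P ⟶ Q) (hF : ∀ k, Function.Bijective (Hom.app F k)) : IsIso F := by
  let e := fun k => Equiv.ofBijective _ (hF k)
  have he : ∀ k x, Hom.app F k ((e k).symm x) = x := fun k x => (e k).apply_symm_apply x
  let G : Q ⟶ P :=
    { app := fun k => (e k).symm
      map_bd := fun ε k g => by
        refine eqv_of_map_eqv (S := P.toSig) (Hom.map_bd F) (fun k => (hF k).1) ?_
        rw [Term.map_map]
        simp only [he]
        rw [Term.map_id']
        refine Eqv.symm (S := Q.toSig) ?_
        have := Hom.map_bd F ε k ((e (k + 1)).symm g)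
        rwa [he] at this }
  refine ⟨G, Hom.ext ?_, Hom.ext ?_⟩
  · funext k x; exact (e k).symm_apply_apply x
  · funext k x; exact he k x

theorem bijective_of_isIso (F : P ⟶ Q) [IsIso F] (k : ℕ) : Function.Bijective (Hom.app F k) := by
  refine Function.bijective_iff_has_inverse.2 ⟨Hom.app (inv F) k, fun x => ?_, fun x => ?_⟩
  · exact congrFun (congrFun (congrArg Hom.app (IsIso.hom_inv_id F)) k) x
  · exact congrFun (congrFun (congrArg Hom.app (IsIso.inv_hom_id F)) k) x

/-! ### Supports and principal elements -/

/-- The support of an image cell consists of generators in the image of `F`; if it is everything,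
nothing is missed. -/
theorem surjective_of_supp_eq_univ (F : P ⟶ Q) (x : P.free.Cell)
    (h : Q.supp ((freeMap F).toFun x) = Set.univ) (k : ℕ) :
    Function.Surjective (Hom.app F k) := by
  obtain ⟨t, ht, rfl⟩ := exists_rep x
  intro g
  have hg : (⟨k, g⟩ : Σ k, Q.Gen k) ∈ Q.suppT (t.map (Hom.app F)) := by
    change (⟨k, g⟩ : Σ k, Q.Gen k) ∈ Q.supp ((freeMap F).toFun (mkCell t ht))
    rw [h]; trivial
  obtain ⟨⟨l, g'⟩, e⟩ := suppT_map_subset_range (S := P.toSig) (Hom.map_bd F) t hg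
  simp only [totalMap, Sigma.mk.injEq] at e
  obtain ⟨rfl, e⟩ := e
  exact ⟨g', eq_of_heq e⟩

theorem isIso_of_mono_of_supp_eq_univ (F : P ⟶ Q) [Mono F] (x : P.free.Cell)
    (h : Q.supp ((freeMap F).toFun x) = Set.univ) : IsIso F :=
  isIso_of_bijective F fun k => ⟨injective_of_mono F k, surjective_of_supp_eq_univ F x h k⟩

theorem eq_univ_of_isIso_subIncl {A : Set (Σ k, P.Gen k)} (hA : IsClosedSet A)
    [IsIso (subIncl hA)] : A = Set.univ := by
  refine Set.eq_univ_of_forall fun x => ?_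
  obtain ⟨y, hy⟩ := (bijective_of_isIso (subIncl hA) x.1).2 x.2
  have : (⟨x.1, subVal A x.1 y⟩ : Σ k, P.Gen k) ∈ A := y.2
  rwa [show subVal A x.1 y = x.2 from hy] at this

instance {A : Set (Σ k, P.Gen k)} (hA : IsClosedSet A) : Mono (subIncl hA) :=
  mono_of_injective _ (subVal_injective A)

theorem isClosedSet_supp (x : P.free.Cell) : IsClosedSet (P.supp x) := by
  obtain ⟨t, ht, rfl⟩ := exists_rep x
  exact isClosedSet_suppT t

/-- An expression for `x` lifts literally to the generators in its support, and reflection makes the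
lift well-formed. -/
theorem exists_freeMap_subIncl_eq (x : P.free.Cell) :
    ∃ y, (freeMap (subIncl (isClosedSet_supp x))).toFun y = x := by
  obtain ⟨t, ht, rfl⟩ := exists_rep x
  obtain ⟨s, hs⟩ := exists_map_subVal_eq (P := P) (A := P.suppT t) (t := t) subset_rfl
  have ht' : P.Eqv (s.map (subVal _)) t := by rw [hs]; exact ht
  have hA := isClosedSet_suppT t
  exact ⟨mkCell (P := sub hA) s (subSig_eqv hA ht'.left),
    (mkCell_eq_iff (map_eqv (subIncl hA) (subSig_eqv hA ht'.left)) ht).2 ht'⟩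

end Pol

/-- Principality of an element tested on the underlying morphisms. -/
theorem isPrincipal_elementsMk_iff {C : Type*} [Category C] (F : C ⥤ Type u) (X : C)
    (x : F.obj X) :
    IsPrincipal F (F.elementsMk X x) ↔
      ∀ (Y : C) (y : F.obj Y) (f : Y ⟶ X), F.map f y = x → Mono f → IsIso f := by
  constructor
  · intro h Y y f hf hm
    have := h (F.elementsMk Y y) ⟨f, hf⟩ hm
    exact (CategoryOfElements.π F).map_isIso
      (⟨f, hf⟩ : F.elementsMk Y y ⟶ F.elementsMk X x)
  · intro h q f hm
    have := h q.1 q.2 f.val f.property hm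
    have : IsIso ((CategoryOfElements.π F).map f) := this
    -- The inverse of an underlying morphism that preserves the chosen elements preserves them too.
    exact isIso_of_reflects_iso f (CategoryOfElements.π F)

end PrecatPol

/-! ### The two characterizations of principal elements -/

open PrecatPol in
theorem isPrincipal_genFunctor_iff (P : Pol.{u}) (g : Σ k, P.Gen k) :
    IsPrincipal Pol.genFunctor (Pol.genFunctor.elementsMk P g) ↔
      P.supp (Pol.genCell g) = Set.univ := by
  refine (isPrincipal_elementsMk_iff _ _ _).trans ?_
  constructor
  · intro h
    have hA := Pol.isClosedSet_supp (Pol.genCell g)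
    have := h (Pol.sub hA) ⟨g.1, g.2, Pol.mem_suppT_gen g.1 g.2⟩ (Pol.subIncl hA) rfl inferInstance
    exact Pol.eq_univ_of_isIso_subIncl hA
  · intro h Q x F hx hF
    refine Pol.isIso_of_mono_of_supp_eq_univ F (Pol.genCell x) ?_
    rw [← h, ← hx]
    -- The cell denoted by the image of the generator `x` is, by definition, the image under
    -- `freeMap F` of the cell denoted by `x`.
    rfl

open PrecatPol in
theorem isPrincipal_freeCellFunctor_iff (P : Pol.{u}) (x : P.free.Cell) :
    IsPrincipal Pol.freeCellFunctor (Pol.freeCellFunctor.elementsMk P x) ↔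
      P.supp x = Set.univ := by
  refine (isPrincipal_elementsMk_iff _ _ _).trans ?_
  constructor
  · intro h
    have hA := Pol.isClosedSet_supp x
    obtain ⟨y, hy⟩ := Pol.exists_freeMap_subIncl_eq x
    have := h (Pol.sub hA) y (Pol.subIncl hA) hy inferInstance
    exact Pol.eq_univ_of_isIso_subIncl hA
  · intro h Q y F hy hF
    refine Pol.isIso_of_mono_of_supp_eq_univ F y ?_
    rw [← h, ← hy]
    rfl

theorem mainTheorem11 :
    (∀ (P : PrecatPol.Pol.{u}) (g : Σ k, P.Gen k),
      PrecatPol.IsPrincipal PrecatPol.Pol.genFunctor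
          (PrecatPol.Pol.genFunctor.elementsMk P g) ↔
        P.supp (PrecatPol.Pol.genCell g) = Set.univ) ∧
    (∀ (P : PrecatPol.Pol.{u}) (x : P.free.Cell),
      PrecatPol.IsPrincipal PrecatPol.Pol.freeCellFunctor
          (PrecatPol.Pol.freeCellFunctor.elementsMk P x) ↔
        P.supp x = Set.univ) :=
  ⟨isPrincipal_genFunctor_iff, isPrincipal_freeCellFunctor_iff⟩
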